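/- Let $G$ be a finite group. Let $\mathrm{cd}(G)$ be the set of degrees of the irreducible complex characters of $G$ and $\mathrm{cc}(G)$ the set of sizes of the conjugacy classes of $G$. Let $ZL^1(G)$ be the centre of the convolution algebra $L^1(G)$, with the $L^1$-norm, and let $ZA(G)$ be the algebra of class functions on $G$ under pointwise multiplication, with the norm of the Fourier algebra $A(G)$, i.e. $\|f\|=\sup\{|\sum_{g} f(g)c(g)| : c\in\mathbb{C}^G,\ \|\sum_g c(g)\lambda(g)\|\le 1\}$ where $\lambda$ is the left regular representation of $G$ on $\ell^2(G)$. For a Banach algebra $\mathcal{A}$ let $\mathrm{AM}(\mathcal{A})$ be its amenability constant: the infimum of $\sup_\alpha\|d_\alpha\|$ over all bounded nets $(d_\alpha)$ in the projective tensor product $\mathcal{A}\hat\otimes\mathcal{A}$ such that $a\cdot d_\alpha-d_\alpha\cdot a\to 0$ and $a\,\mu(d_\alpha)\to a$ for all $a\in\mathcal{A}$, where $a\cdot(b\otimes c)=ab\otimes c$, $(b\otimes c)\cdot a=b\otimes ca$ and $\mu(b\otimes c)=bc$; it is $\infty$ if there is no such net. If $\mathrm{cd}(G)=\{1,m\}$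 and $\mathrm{cc}(G)=\{1,s\}$ for some positive integers $m$ and $s$, then $$\mathrm{AM}(ZA(G))=\mathrm{AM}(ZL^1(G)).$$ -/

import Mathlib

open scoped TensorProduct ENNReal Topology

noncomputable section

namespace CentralFourier

universe u

/-! ### The projective tensor product -/

section Projective

variable (E F : Type*) [NormedAddCommGroup E] [NormedSpace ℂ E]
  [NormedAddCommGroup F] [NormedSpace ℂ F]

/-- The algebraic tensor product of two normed spaces over `ℂ`, to be equipped with the
projective seminorm. -/
def AlgTensor : Type _ := E ⊗[ℂ] F

instance : AddCommGroup (AlgTensor E F) := inferInstanceAs (AddCommGroup (E ⊗[ℂ] F))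
instance : Module ℂ (AlgTensor E F) := inferInstanceAs (Module ℂ (E ⊗[ℂ] F))

variable {E F}

/-- The elementary tensor `x ⊗ y`. -/
def AlgTensor.tmul (x : E) (y : F) : AlgTensor E F := x ⊗ₜ[ℂ] y

/-- The tensor `∑ xᵢ ⊗ yᵢ` given by a finite list of pairs `(xᵢ, yᵢ)`. -/
def listTensor (l : List (E × F)) : AlgTensor E F :=
  (l.map fun p => AlgTensor.tmul p.1 p.2).sum

/-- The sum `∑ ‖xᵢ‖ ‖yᵢ‖` over a finite list of pairs `(xᵢ, yᵢ)`. -/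
def listCost (l : List (E × F)) : ℝ :=
  (l.map fun p => ‖p.1‖ * ‖p.2‖).sum

/-- The projective seminorm: the infimum of `∑ ‖xᵢ‖ ‖yᵢ‖` over all finite
representations `u = ∑ xᵢ ⊗ yᵢ`. -/
instance : Norm (AlgTensor E F) where
  norm u := sInf {r : ℝ | ∃ l : List (E × F), listTensor l = u ∧ listCost l = r}

theorem listCost_nonneg (l : List (E × F)) : 0 ≤ listCost l := by
  apply List.sum_nonneg
  intro r hr
  obtain ⟨p, -, rfl⟩ := List.mem_map.1 hr
  positivity

theorem exists_listTensor (u : AlgTensor E F) : ∃ l : List (E × F), listTensor l = u := by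
  refine TensorProduct.induction_on
    (motive := fun u : E ⊗[ℂ] F => ∃ l : List (E × F), listTensor l = (u : AlgTensor E F))
    u ⟨[], rfl⟩ (fun x y => ⟨[(x, y)], ?_⟩) ?_
  · simp only [listTensor, List.map_cons, List.map_nil, List.sum_cons, List.sum_nil, add_zero]
    rfl
  · rintro a b ⟨l, rfl⟩ ⟨l', rfl⟩
    refine ⟨l ++ l', ?_⟩
    simp only [listTensor, List.map_append, List.sum_append]
    rfl

theorem projNorm_le (l : List (E × F)) : ‖listTensor l‖ ≤ listCost l :=
  csInf_le ⟨0, by rintro r ⟨l, -, rfl⟩; exact listCost_nonneg l⟩ ⟨l, rfl, rfl⟩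

theorem le_projNorm {u : AlgTensor E F} {c : ℝ}
    (h : ∀ l : List (E × F), listTensor l = u → c ≤ listCost l) : c ≤ ‖u‖ := by
  obtain ⟨l, hl⟩ := exists_listTensor u
  refine le_csInf ⟨_, l, hl, rfl⟩ ?_
  rintro r ⟨l, hl, rfl⟩
  exact h l hl

theorem projNorm_add_le (u v : AlgTensor E F) : ‖u + v‖ ≤ ‖u‖ + ‖v‖ := by
  rw [← sub_le_iff_le_add]
  refine le_projNorm fun l hl => ?_
  rw [sub_le_comm]
  refine le_projNorm fun l' hl' => ?_
  rw [sub_le_iff_le_add, add_comm (listCost l')]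
  have h := projNorm_le (l ++ l')
  have h1 : listTensor (l ++ l') = u + v := by
    rw [← hl, ← hl']; simp [listTensor]
  have h2 : listCost (l ++ l') = listCost l + listCost l' := by simp [listCost]
  rwa [h1, h2] at h

theorem projNorm_smul_le (c : ℂ) (u : AlgTensor E F) : ‖c • u‖ ≤ ‖c‖ * ‖u‖ := by
  have key : ∀ l : List (E × F), listTensor l = u → ‖c • u‖ ≤ ‖c‖ * listCost l := by
    intro l hl
    have h := projNorm_le (l.map fun p => (c • p.1, p.2))
    have h1 : listTensor (l.map fun p => (c • p.1, p.2)) = c • u := by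
      rw [← hl]
      simp only [listTensor, List.map_map, List.smul_sum]
      rfl
    have h2 : listCost (l.map fun p => (c • p.1, p.2)) = ‖c‖ * listCost l := by
      simp only [listCost, List.map_map, ← List.sum_map_mul_left]
      congr 1
      apply List.map_congr_left
      intro p _
      simp [norm_smul, mul_assoc]
    rwa [h1, h2] at h
  rcases eq_or_ne c 0 with rfl | hc
  · obtain ⟨l, hl⟩ := exists_listTensor u
    simpa using key l hl
  · have hc' : 0 < ‖c‖ := norm_pos_iff.2 hc
    rw [← div_le_iff₀' hc']
    exact le_projNorm fun l hl => (div_le_iff₀' hc').2 (key l hl)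

theorem projNorm_zero : ‖(0 : AlgTensor E F)‖ = 0 := by
  refine le_antisymm ?_ (le_projNorm fun l _ => listCost_nonneg l)
  simpa [listTensor, listCost] using projNorm_le ([] : List (E × F))

instance : SeminormedAddCommGroup (AlgTensor E F) :=
  AddGroupSeminorm.toSeminormedAddCommGroup
    { toFun := fun u => ‖u‖
      map_zero' := projNorm_zero
      add_le' := projNorm_add_le
      neg' := by
        have h : ∀ u : AlgTensor E F, ‖-u‖ ≤ ‖u‖ := fun u => by
          simpa using projNorm_smul_le (-1) u
        exact fun u => le_antisymm (h u) (by simpa using h (-u)) }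

instance : NormedSpace ℂ (AlgTensor E F) where
  norm_smul_le := projNorm_smul_le

variable (E F) in
/-- The projective tensor product `E ⊗̂ F`: the completion of the algebraic tensor product in the
projective norm. -/
abbrev ProjTensor : Type _ := UniformSpace.Completion (AlgTensor E F)

variable {X : Type*} [SeminormedAddCommGroup X] [NormedSpace ℂ X]

theorem norm_apply_le_of_tmul (T : AlgTensor E F →ₗ[ℂ] X) (C : ℝ) (hC : 0 ≤ C)
    (h : ∀ x y, ‖T (AlgTensor.tmul x y)‖ ≤ C * (‖x‖ * ‖y‖)) (u : AlgTensor E F) :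
    ‖T u‖ ≤ C * ‖u‖ := by
  have key : ∀ l : List (E × F), ‖T (listTensor l)‖ ≤ C * listCost l := by
    intro l
    induction l with
    | nil => simp [listTensor, listCost]
    | cons p l ih =>
      have h1 : listTensor (p :: l) = AlgTensor.tmul p.1 p.2 + listTensor l := by
        simp [listTensor]
      have h2 : listCost (p :: l) = ‖p.1‖ * ‖p.2‖ + listCost l := by simp [listCost]
      rw [h1, h2, map_add, mul_add]
      exact (norm_add_le _ _).trans (add_le_add (h _ _) ih)
  rcases hC.eq_or_lt with rfl | hC'
  · obtain ⟨l, rfl⟩ := exists_listTensor u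
    simpa using key l
  · rw [← div_le_iff₀' hC']
    refine le_projNorm fun l hl => (div_le_iff₀' hC').2 ?_
    rw [← hl]
    exact key l

end Projective

/-! ### Amenability constants of Banach algebras -/

section Amenability

variable {A : Type u} [NormedRing A] [NormedAlgebra ℂ A]

theorem norm_tmul_le (x y : A) : ‖AlgTensor.tmul x y‖ ≤ ‖x‖ * ‖y‖ := by
  simpa [listTensor, listCost] using projNorm_le [(x, y)]

/-- The left action `a · (b ⊗ c) = (a b) ⊗ c` on the algebraic tensor product. -/
def leftActAlg (a : A) : AlgTensor A A →L[ℂ] AlgTensor A A :=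
  LinearMap.mkContinuous
    (show A ⊗[ℂ] A →ₗ[ℂ] A ⊗[ℂ] A from LinearMap.rTensor A (LinearMap.mulLeft ℂ a)) ‖a‖
    (norm_apply_le_of_tmul (E := A) (F := A) (X := AlgTensor A A) _ _ (norm_nonneg a)
      fun x y => by
        refine (norm_tmul_le (a * x) y).trans ?_
        rw [← mul_assoc]
        exact mul_le_mul_of_nonneg_right (norm_mul_le a x) (norm_nonneg y))

/-- The right action `(b ⊗ c) · a = b ⊗ (c a)` on the algebraic tensor product. -/
def rightActAlg (a : A) : AlgTensor A A →L[ℂ] AlgTensor A A :=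
  LinearMap.mkContinuous
    (show A ⊗[ℂ] A →ₗ[ℂ] A ⊗[ℂ] A from LinearMap.lTensor A (LinearMap.mulRight ℂ a)) ‖a‖
    (norm_apply_le_of_tmul (E := A) (F := A) (X := AlgTensor A A) _ _ (norm_nonneg a)
      fun x y => by
        refine (norm_tmul_le x (y * a)).trans ?_
        rw [mul_left_comm, mul_comm ‖a‖ ‖y‖]
        exact mul_le_mul_of_nonneg_left (norm_mul_le y a) (norm_nonneg x))

variable (A) in
/-- The multiplication map `m (a ⊗ b) = a b` on the algebraic tensor product. -/
def mulMapAlg : AlgTensor A A →L[ℂ] A :=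
  LinearMap.mkContinuous (show A ⊗[ℂ] A →ₗ[ℂ] A from LinearMap.mul' ℂ A) 1
    (norm_apply_le_of_tmul (E := A) (F := A) (X := A) _ _ zero_le_one fun x y => by
        rw [one_mul]
        exact norm_mul_le x y)

/-- The left action of `A` on `A ⊗̂ A`, extended by continuity. -/
def leftAct (a : A) : ProjTensor A A →L[ℂ] ProjTensor A A :=
  (UniformSpace.Completion.toComplL.comp (leftActAlg a)).extend UniformSpace.Completion.toComplL

/-- The right action of `A` on `A ⊗̂ A`, extended by continuity. -/
def rightAct (a : A) : ProjTensor A A →L[ℂ] ProjTensor A A :=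
  (UniformSpace.Completion.toComplL.comp (rightActAlg a)).extend UniformSpace.Completion.toComplL

variable (A) in
/-- The multiplication map `A ⊗̂ A → A`, extended by continuity. -/
def mulMap [CompleteSpace A] : ProjTensor A A →L[ℂ] A :=
  (mulMapAlg A).extend UniformSpace.Completion.toComplL

theorem leftAct_tmul (a b c : A) :
    leftAct a (AlgTensor.tmul b c : AlgTensor A A) = (AlgTensor.tmul (a * b) c : AlgTensor A A) :=
  ContinuousLinearMap.extend_eq _ UniformSpace.Completion.denseRange_coe
    (UniformSpace.Completion.isUniformInducing_coe _) _

theorem rightAct_tmul (a b c : A) :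
    rightAct a (AlgTensor.tmul b c : AlgTensor A A) = (AlgTensor.tmul b (c * a) : AlgTensor A A) :=
  ContinuousLinearMap.extend_eq _ UniformSpace.Completion.denseRange_coe
    (UniformSpace.Completion.isUniformInducing_coe _) _

theorem mulMap_tmul [CompleteSpace A] (a b : A) :
    mulMap A (AlgTensor.tmul a b : AlgTensor A A) = a * b :=
  (ContinuousLinearMap.extend_eq _ UniformSpace.Completion.denseRange_coe
    (UniformSpace.Completion.isUniformInducing_coe _) _).trans
      (LinearMap.mul'_apply (R := ℂ))

/-- A bounded approximate diagonal for the Banach algebra `A`: a bounded net `d` in `A ⊗̂ A` with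
`a · dᵢ - dᵢ · a → 0` and `a m(dᵢ) → a` for every `a`. -/
structure IsBoundedApproxDiagonal [CompleteSpace A] {ι : Type*} [Preorder ι]
    (d : ι → ProjTensor A A) : Prop where
  bounded : ∃ M : ℝ, ∀ i, ‖d i‖ ≤ M
  commute : ∀ a : A, Filter.Tendsto (fun i => leftAct a (d i) - rightAct a (d i)) Filter.atTop (𝓝 0)
  unit : ∀ a : A, Filter.Tendsto (fun i => a * mulMap A (d i)) Filter.atTop (𝓝 a)

variable (A) in
/-- The amenability constant `AM(A)`: the infimum of `supᵢ ‖dᵢ‖` over all bounded approximate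
diagonals `d`, indexed by nonempty directed sets; it is `∞` if there is none. Index sets in the
universe of `A` suffice, since the pairs of a finite subset of `A` and a natural number are among
them. -/
def amenabilityConstant [CompleteSpace A] : ℝ≥0∞ :=
  sInf {c : ℝ≥0∞ | ∃ (ι : Type u) (_ : Preorder ι) (_ : IsDirectedOrder ι) (_ : Nonempty ι)
    (d : ι → ProjTensor A A), IsBoundedApproxDiagonal d ∧ c = ⨆ i, ‖d i‖ₑ}

end Amenability

/-! ### The centre of the group algebra -/

section GroupAlgebra

variable (G : Type u) [Group G] [Fintype G]

/-- `L¹(G)` for a finite group `G`, with convolution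
`(f * h)(x) = ∑_{y z = x} f(y) h(z)` as multiplication. The Haar measure is counting measure. -/
def L1 : Type u := MonoidAlgebra ℂ G

instance : Ring (L1 G) := inferInstanceAs (Ring (MonoidAlgebra ℂ G))
instance : Algebra ℂ (L1 G) := inferInstanceAs (Algebra ℂ (MonoidAlgebra ℂ G))

variable {G}

/-- The value at `x` of an element of `L¹(G)`. -/
def L1.val (f : L1 G) (x : G) : ℂ := MonoidAlgebra.coeff f x

/-- The `L¹`-norm `∑ |f(x)|`. -/
instance : Norm (L1 G) where
  norm f := ∑ x, ‖f.val x‖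

theorem L1.norm_def (f : L1 G) : ‖f‖ = ∑ x, ‖f.val x‖ := rfl

theorem L1.val_mul (f h : L1 G) (x : G) :
    (f * h).val x = ∑ y, f.val y * h.val (y⁻¹ * x) := by
  classical
  have h0 : (f * h).val x = _ := MonoidAlgebra.coeff_mul (R := ℂ) f h x
  rw [h0, Finsupp.sum_fintype _ _ (by simp)]
  refine Finset.sum_congr rfl fun y _ => ?_
  rw [Finsupp.sum_fintype _ _ (by simp), Finset.sum_eq_single (y⁻¹ * x)]
  · simp [L1.val]
  · intro z _ hz
    rw [if_neg]
    rintro rfl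
    simp at hz
  · simp

theorem L1.norm_mul_le' (f h : L1 G) : ‖f * h‖ ≤ ‖f‖ * ‖h‖ := by
  simp only [L1.norm_def, L1.val_mul]
  calc ∑ x, ‖∑ y, f.val y * h.val (y⁻¹ * x)‖
      ≤ ∑ x, ∑ y, ‖f.val y‖ * ‖h.val (y⁻¹ * x)‖ := by
        refine Finset.sum_le_sum fun x _ => (norm_sum_le _ _).trans ?_
        simp
    _ = ∑ y, ‖f.val y‖ * ∑ x, ‖h.val (y⁻¹ * x)‖ := by
        rw [Finset.sum_comm]; simp [Finset.mul_sum]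
    _ = (∑ x, ‖f.val x‖) * ∑ x, ‖h.val x‖ := by
        rw [Finset.sum_mul]
        refine Finset.sum_congr rfl fun y _ => ?_
        congr 1
        exact Equiv.sum_comp (Equiv.mulLeft y⁻¹) fun x => ‖h.val x‖

theorem L1.val_add (f h : L1 G) (x : G) : (f + h).val x = f.val x + h.val x := rfl
theorem L1.val_neg (f : L1 G) (x : G) : (-f).val x = - f.val x := rfl
theorem L1.val_smul (c : ℂ) (f : L1 G) (x : G) : (c • f).val x = c * f.val x := rfl

instance : NormedAddCommGroup (L1 G) :=
  AddGroupNorm.toNormedAddCommGroup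
    { toFun := fun f => ‖f‖
      map_zero' := by
        rw [L1.norm_def]
        exact Finset.sum_eq_zero fun x _ => norm_zero
      add_le' := fun f h => by
        simp only [L1.norm_def, L1.val_add, ← Finset.sum_add_distrib]
        exact Finset.sum_le_sum fun x _ => norm_add_le _ _
      neg' := fun f => by simp only [L1.norm_def, L1.val_neg, norm_neg]
      eq_zero_of_map_eq_zero' := fun f hf => by
        rw [L1.norm_def, Finset.sum_eq_zero_iff_of_nonneg fun _ _ => norm_nonneg _] at hf
        refine MonoidAlgebra.coeff_injective (R := ℂ) (M := G) (Finsupp.ext fun x => ?_)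
        exact norm_eq_zero.1 (hf x (Finset.mem_univ x)) }

instance : NormedRing (L1 G) :=
  { (inferInstance : NormedAddCommGroup (L1 G)), (inferInstance : Ring (L1 G)) with
    norm_mul_le := L1.norm_mul_le' }

instance : NormedAlgebra ℂ (L1 G) where
  norm_smul_le c f := by simp only [L1.norm_def, L1.val_smul, norm_mul, Finset.mul_sum, le_refl]

instance : FiniteDimensional ℂ (L1 G) :=
  Module.Finite.equiv (MonoidAlgebra.coeffLinearEquiv ℂ : MonoidAlgebra ℂ G ≃ₗ[ℂ] (G →₀ ℂ)).symm

variable (G) in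
/-- `ZL¹(G)`, the centre of the Banach algebra `L¹(G)`. -/
abbrev ZL1 : Type u := Subalgebra.center ℂ (L1 G)

instance : CompleteSpace (ZL1 G) := FiniteDimensional.complete ℂ _

end GroupAlgebra

/-! ### The central Fourier algebra -/

section Fourier

variable {G : Type u} [Group G] [Fintype G]

/-- The operator `λ(c) = ∑ c(g) λ(g)` on `ℓ²(G)`, where `λ` is the left regular representation
`(λ(g) ξ)(x) = ξ(g⁻¹ x)`. -/
def leftReg (c : G → ℂ) : EuclideanSpace ℂ G →L[ℂ] EuclideanSpace ℂ G :=
  LinearMap.toContinuousLinearMap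
    { toFun := fun ξ => WithLp.toLp 2 fun x => ∑ g, c g * ξ (g⁻¹ * x)
      map_add' := fun ξ η => by
        ext x; simp [mul_add, Finset.sum_add_distrib]
      map_smul' := fun a ξ => by
        ext x; simp [Finset.mul_sum, mul_left_comm] }

theorem leftReg_apply (c : G → ℂ) (ξ : EuclideanSpace ℂ G) (x : G) :
    leftReg c ξ x = ∑ g, c g * ξ (g⁻¹ * x) := rfl

variable (G) in
/-- The Fourier algebra `A(G)` of a finite group: all functions on `G`, with pointwise
operations. It is normed as the predual of the von Neumann algebra generated by the left regular
representation `λ`: the norm of `f` is the norm of the functional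
`∑ c(g) λ(g) ↦ ∑ f(g) c(g)`. -/
def FourierAlgebra : Type u := G → ℂ

instance : CommRing (FourierAlgebra G) := inferInstanceAs (CommRing (G → ℂ))
instance : Algebra ℂ (FourierAlgebra G) := inferInstanceAs (Algebra ℂ (G → ℂ))

/-- The pairing `∑ f(g) c(g)`. -/
def pairing (f c : G → ℂ) : ℂ := ∑ g, f g * c g

/-- The norm of `f ∈ A(G)`: the least `M ≥ 0` with `|∑ f(g) c(g)| ≤ M ‖λ(c)‖` for all `c`. -/
instance : Norm (FourierAlgebra G) where
  norm f := sInf {M : ℝ | 0 ≤ M ∧ ∀ c : G → ℂ, ‖pairing f c‖ ≤ M * ‖leftReg c‖}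

theorem norm_coeff_le_leftReg (c : G → ℂ) (g : G) : ‖c g‖ ≤ ‖leftReg c‖ := by
  classical
  have h1 : leftReg c (EuclideanSpace.single 1 1) g = c g := by
    rw [leftReg_apply, Finset.sum_eq_single g]
    · simp
    · intro h _ hh
      have : h⁻¹ * g ≠ 1 := fun h' => hh (inv_mul_eq_one.1 h')
      simp [this]
    · simp
  calc ‖c g‖ = ‖leftReg c (EuclideanSpace.single 1 1) g‖ := by rw [h1]
    _ ≤ ‖leftReg c (EuclideanSpace.single 1 1)‖ := PiLp.norm_apply_le _ _
    _ ≤ ‖leftReg c‖ * ‖(EuclideanSpace.single 1 1 : EuclideanSpace ℂ G)‖ :=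
        (leftReg c).le_opNorm _
    _ = ‖leftReg c‖ := by simp

theorem fourierNorm_le {f : FourierAlgebra G} {M : ℝ} (hM : 0 ≤ M)
    (h : ∀ c : G → ℂ, ‖pairing f c‖ ≤ M * ‖leftReg c‖) : ‖f‖ ≤ M :=
  csInf_le ⟨0, fun _ h => h.1⟩ ⟨hM, h⟩

theorem fourierSet_nonempty (f : FourierAlgebra G) :
    {M : ℝ | 0 ≤ M ∧ ∀ c : G → ℂ, ‖pairing f c‖ ≤ M * ‖leftReg c‖}.Nonempty := by
  refine ⟨∑ g, ‖f g‖, by positivity, fun c => ?_⟩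
  rw [Finset.sum_mul]
  refine (norm_sum_le _ _).trans (Finset.sum_le_sum fun g _ => ?_)
  rw [norm_mul]
  exact mul_le_mul_of_nonneg_left (norm_coeff_le_leftReg c g) (norm_nonneg _)

theorem fourierNorm_nonneg (f : FourierAlgebra G) : 0 ≤ ‖f‖ :=
  le_csInf (fourierSet_nonempty f) fun _ h => h.1

theorem norm_pairing_le (f : FourierAlgebra G) (c : G → ℂ) :
    ‖pairing f c‖ ≤ ‖f‖ * ‖leftReg c‖ := by
  rcases (norm_nonneg (leftReg c)).eq_or_lt with h0 | h0
  · obtain ⟨M, -, hM⟩ := fourierSet_nonempty f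
    have := hM c
    rw [← h0] at this ⊢
    simpa using this
  · rw [← div_le_iff₀ h0]
    exact le_csInf (fourierSet_nonempty f) fun M hM => (div_le_iff₀ h0).2 (hM.2 c)

theorem opNorm_le_of_inner {T : EuclideanSpace ℂ G →L[ℂ] EuclideanSpace ℂ G} {K : ℝ}
    (hK : 0 ≤ K) (h : ∀ u v, ‖inner ℂ v (T u)‖ ≤ K * ‖u‖ * ‖v‖) : ‖T‖ ≤ K := by
  refine T.opNorm_le_bound hK fun u => ?_
  rcases (norm_nonneg (T u)).eq_or_lt with h0 | h0
  · rw [← h0]; positivity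
  · have h1 := h u (T u)
    rw [inner_self_eq_norm_sq_to_K, norm_pow] at h1
    simp only [Complex.coe_algebraMap, Complex.norm_real, norm_norm] at h1
    rw [sq] at h1
    exact le_of_mul_le_mul_right h1 h0

/-- Multiplying `c` by a coefficient function of the regular representation. -/
theorem norm_leftReg_coeff_mul_le (c : G → ℂ) (ξ η : EuclideanSpace ℂ G) :
    ‖leftReg fun g => c g * ∑ x, star (η x) * ξ (g⁻¹ * x)‖ ≤ ‖leftReg c‖ * (‖ξ‖ * ‖η‖) := by
  refine opNorm_le_of_inner (by positivity) fun u v => ?_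
  let U : G → EuclideanSpace ℂ G := fun t => WithLp.toLp 2 fun y => u y * ξ (y * t)
  let V : G → EuclideanSpace ℂ G := fun t => WithLp.toLp 2 fun y => v y * η (y * t)
  have hU : ∀ (u ξ : EuclideanSpace ℂ G),
      ∑ t, ‖(WithLp.toLp 2 fun y => u y * ξ (y * t) : EuclideanSpace ℂ G)‖ ^ 2
        = (‖u‖ * ‖ξ‖) ^ 2 := by
    intro u ξ
    simp only [mul_pow, EuclideanSpace.norm_sq_eq, norm_mul]
    rw [Finset.sum_comm, Finset.sum_mul]
    refine Finset.sum_congr rfl fun y _ => ?_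
    rw [← Finset.mul_sum]
    congr 1
    exact Equiv.sum_comp (Equiv.mulLeft y) fun x => ‖ξ x‖ ^ 2
  have key : inner ℂ v (leftReg (fun g => c g * ∑ x, star (η x) * ξ (g⁻¹ * x)) u)
      = ∑ t, inner ℂ (V t) (leftReg c (U t)) := by
    simp only [PiLp.inner_apply, leftReg_apply, RCLike.inner_apply, U, V]
    rw [Finset.sum_comm]
    refine Finset.sum_congr rfl fun y _ => ?_
    simp only [Finset.sum_mul]
    rw [Finset.sum_comm]
    refine Finset.sum_congr rfl fun g _ => ?_
    rw [← Equiv.sum_comp (Equiv.mulLeft y)]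
    simp only [Finset.mul_sum, Finset.sum_mul]
    refine Finset.sum_congr rfl fun t _ => ?_
    simp only [Equiv.coe_mulLeft, map_mul, mul_assoc]
    simp only [RCLike.star_def]
    ring
  rw [key]
  calc ‖∑ t, inner ℂ (V t) (leftReg c (U t))‖
      ≤ ∑ t, ‖leftReg c‖ * (‖U t‖ * ‖V t‖) := by
        refine (norm_sum_le _ _).trans (Finset.sum_le_sum fun t _ => ?_)
        refine (norm_inner_le_norm _ _).trans ?_
        calc ‖V t‖ * ‖leftReg c (U t)‖ ≤ ‖V t‖ * (‖leftReg c‖ * ‖U t‖) :=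
              mul_le_mul_of_nonneg_left ((leftReg c).le_opNorm _) (norm_nonneg _)
          _ = _ := by ring
    _ = ‖leftReg c‖ * ∑ t, ‖U t‖ * ‖V t‖ := by rw [Finset.mul_sum]
    _ ≤ ‖leftReg c‖ * (√(∑ t, ‖U t‖ ^ 2) * √(∑ t, ‖V t‖ ^ 2)) :=
        mul_le_mul_of_nonneg_left (Real.sum_mul_le_sqrt_mul_sqrt _ _ _) (norm_nonneg _)
    _ = ‖leftReg c‖ * (‖ξ‖ * ‖η‖) * ‖u‖ * ‖v‖ := by
        rw [hU u ξ, hU v η, Real.sqrt_sq (by positivity), Real.sqrt_sq (by positivity)]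
        ring

theorem norm_leftReg_mul_le (h : FourierAlgebra G) (c : G → ℂ) :
    ‖leftReg fun g => h g * c g‖ ≤ ‖h‖ * ‖leftReg c‖ := by
  have hh := fourierNorm_nonneg h
  refine opNorm_le_of_inner (by positivity) fun ξ η => ?_
  have key : inner ℂ η (leftReg (fun g => h g * c g) ξ)
      = pairing h fun g => c g * ∑ x, star (η x) * ξ (g⁻¹ * x) := by
    simp only [PiLp.inner_apply, leftReg_apply, RCLike.inner_apply, pairing, Finset.mul_sum,
      Finset.sum_mul]
    rw [Finset.sum_comm]
    refine Finset.sum_congr rfl fun g _ => Finset.sum_congr rfl fun x _ => ?_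
    simp only [RCLike.star_def]
    ring
  rw [key]
  calc _ ≤ ‖h‖ * ‖leftReg fun g => c g * ∑ x, star (η x) * ξ (g⁻¹ * x)‖ := norm_pairing_le h _
    _ ≤ ‖h‖ * (‖leftReg c‖ * (‖ξ‖ * ‖η‖)) :=
        mul_le_mul_of_nonneg_left (norm_leftReg_coeff_mul_le c ξ η) hh
    _ = _ := by ring

theorem fourierNorm_mul_le (f h : FourierAlgebra G) : ‖f * h‖ ≤ ‖f‖ * ‖h‖ := by
  have hf := fourierNorm_nonneg f
  have hh := fourierNorm_nonneg h
  refine fourierNorm_le (by positivity) fun c => ?_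
  have h1 : pairing (f * h : FourierAlgebra G) c = pairing f fun g => h g * c g :=
    Finset.sum_congr rfl fun g _ => mul_assoc (f g) (h g) (c g)
  rw [h1, mul_assoc]
  exact (norm_pairing_le f _).trans (mul_le_mul_of_nonneg_left (norm_leftReg_mul_le h c) hf)

theorem fourierNorm_smul_le (a : ℂ) (f : FourierAlgebra G) : ‖a • f‖ ≤ ‖a‖ * ‖f‖ := by
  have hf := fourierNorm_nonneg f
  refine fourierNorm_le (by positivity) fun c => ?_
  have h1 : pairing (a • f : FourierAlgebra G) c = a * pairing f c := by
    exact (Finset.sum_congr rfl fun g _ => mul_assoc a (f g) (c g)).trans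
      (Finset.mul_sum Finset.univ (fun g => f g * c g) a).symm
  rw [h1, norm_mul, mul_assoc]
  exact mul_le_mul_of_nonneg_left (norm_pairing_le f c) (norm_nonneg a)

theorem fourierNorm_zero : ‖(0 : FourierAlgebra G)‖ = 0 := by
  simpa using le_antisymm (by simpa using fourierNorm_smul_le 0 (0 : FourierAlgebra G))
    (fourierNorm_nonneg 0)

instance : NormedAddCommGroup (FourierAlgebra G) :=
  AddGroupNorm.toNormedAddCommGroup
    { toFun := fun f => ‖f‖
      map_zero' := fourierNorm_zero
      add_le' := fun f h => by
        have hf := fourierNorm_nonneg f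
        have hh := fourierNorm_nonneg h
        refine fourierNorm_le (by positivity) fun c => ?_
        have h1 : pairing (f + h : FourierAlgebra G) c = pairing f c + pairing h c := by
          exact (Finset.sum_congr rfl fun g _ => add_mul (f g) (h g) (c g)).trans
            Finset.sum_add_distrib
        rw [h1, add_mul]
        exact (norm_add_le _ _).trans (add_le_add (norm_pairing_le f c) (norm_pairing_le h c))
      neg' := by
        have h : ∀ f : FourierAlgebra G, ‖-f‖ ≤ ‖f‖ := fun f => by
          simpa using fourierNorm_smul_le (-1) f
        exact fun f => le_antisymm (h f) (by simpa using h (-f))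
      eq_zero_of_map_eq_zero' := fun f hf => by
        classical
        have hf' : ‖f‖ = 0 := hf
        funext g
        have h1 := norm_pairing_le f (Pi.single g 1)
        rw [hf', zero_mul] at h1
        have h2 : pairing f (Pi.single g 1) = f g := by
          refine (Finset.sum_eq_single g (fun x _ hx => ?_) (by simp)).trans ?_
          · simp [hx]
          · simp
        rw [h2] at h1
        exact norm_le_zero_iff.1 h1 }

instance : NormedRing (FourierAlgebra G) :=
  { (inferInstance : NormedAddCommGroup (FourierAlgebra G)),
    (inferInstance : CommRing (FourierAlgebra G)) with
    norm_mul_le := fourierNorm_mul_le }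

instance : NormedAlgebra ℂ (FourierAlgebra G) where
  norm_smul_le := fourierNorm_smul_le

instance : FiniteDimensional ℂ (FourierAlgebra G) :=
  inferInstanceAs (FiniteDimensional ℂ (G → ℂ))

variable (G) in
/-- The subalgebra of class functions in `A(G)`. -/
def classFunctions : Subalgebra ℂ (FourierAlgebra G) where
  carrier := {f | ∀ g x : G, f (x * g * x⁻¹) = f g}
  mul_mem' hf hh g x := congrArg₂ (· * ·) (hf g x) (hh g x)
  add_mem' hf hh g x := congrArg₂ (· + ·) (hf g x) (hh g x)
  algebraMap_mem' _ _ _ := rfl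

variable (G) in
/-- `ZA(G)`, the central Fourier algebra: the class functions on `G` (equivalently, the span of the
irreducible characters) with the norm of `A(G)` and pointwise multiplication. -/
abbrev ZA : Type u := classFunctions G

instance : CompleteSpace (ZA G) := FiniteDimensional.complete ℂ _

end Fourier

/-! ### Character degrees and class sizes -/

section Degrees

variable (G : Type u) [Group G]

/-- `cd(G)`: the set of degrees of the irreducible complex characters of `G`, that is, of the
dimensions of the irreducible complex representations. -/
def cd : Set ℕ := {n | ∃ ρ : Representation ℂ G (Fin n → ℂ), ρ.IsIrreducible}

/-- `cc(G)`: the set of sizes of the conjugacy classes of `G`. -/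
def cc : Set ℕ := {n | ∃ C : ConjClasses G, Nat.card C.carrier = n}

end Degrees

end CentralFourier

end

open scoped TensorProduct ENNReal Topology

set_option linter.unusedSectionVars false

namespace CentralFourier

universe u

/-! ### Diagonals and projective norms for algebras spanned by orthogonal idempotents -/

section ApproxDiagonal

variable {A : Type u} [NormedRing A] [NormedAlgebra ℂ A]

/-! Both algebras are spanned by orthogonal idempotents: the block idempotents for `ZL1 G`, the
class indicators for `ZA G`. In such an algebra every bounded approximate diagonal converges to `∑ e
⊗ e`, so the amenability constant is the projective norm of that tensor
(`amenabilityConstant_eq_enorm_diagonal`). Both norms are weighted ℓ¹ norms, in the values of the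
function for `ZL1 G` and in the Fourier coefficients with weights `d i` for `ZA G`, and the
projective tensor product of ℓ¹ spaces is again ℓ¹ (`norm_diagonal_eq`). With n = |G| and C_g the
class of g, this gives n² AM(ZL¹) = ∑_{g,h} |∑_i d_i² χ_i(g) χ_i(h⁻¹)| and n² AM(ZA) = ∑_{i,j} d_i
d_j |∑_g |C_g| χ_i(g⁻¹) χ_j(g)|.

Now write d_i² = m² − (m² − 1)[d_i = 1] and |C_g| = s − (s − 1)[g ∈ Z(G)]. The constant parts are
evaluated by column and row orthogonality; the corrections are sums over linear characters and over
the centre, again evaluated by orthogonality. The bounds l ≤ n/|C_g| and d_i² z ≤ n, where l is the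
number of linear characters and z = |Z(G)|, fix the sign of every term, so the absolute values can
be removed (`sum_norm_sum_degree_sq_mul_chr`, `sum_degree_mul_norm_sum_classSize`): n² AM(ZL¹) =
(2m² − 1)n² − 2(m² − 1) l ∑_g |C_g|, n² AM(ZA) = (2s − 1)n² − 2(s − 1) z ∑_i d_i⁴.

Let k be the number of irreducible characters, which is the number of classes. Counting gives m²k =
n + (m² − 1)l and sk = n + (s − 1)z, and then both expressions equal (2m² + 2s − 1)n² − 2m²skn +
2(m² − 1)(s − 1)lz.

The character theory is derived from a Wedderburn isomorphism `φ` by comparing traces of left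
multiplication (`card_mul_val_one`). -/

theorem ProjTensor.ext_tmul {X : Type*} [NormedAddCommGroup X] [NormedSpace ℂ X]
    {S T : ProjTensor A A →L[ℂ] X}
    (h : ∀ x y : A, S (AlgTensor.tmul x y : AlgTensor A A) =
      T (AlgTensor.tmul x y : AlgTensor A A)) (u : ProjTensor A A) : S u = T u := by
  induction u using UniformSpace.Completion.induction_on with
  | hp => exact isClosed_eq S.continuous T.continuous
  | ih u =>
    obtain ⟨l, rfl⟩ := exists_listTensor u
    induction l with
    | nil =>
      rw [show listTensor ([] : List (A × A)) = 0 from rfl, UniformSpace.Completion.coe_zero,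
        map_zero, map_zero]
    | cons p l ih =>
      have h1 : listTensor (p :: l) = AlgTensor.tmul p.1 p.2 + listTensor l := by
        simp [listTensor]
      rw [h1, UniformSpace.Completion.coe_add, map_add, map_add, ih, h]

theorem leftAct_leftAct (a b : A) (u : ProjTensor A A) :
    leftAct a (leftAct b u) = leftAct (a * b) u := by
  refine ProjTensor.ext_tmul (S := (leftAct a).comp (leftAct b)) (fun x y => ?_) u
  simp [leftAct_tmul, mul_assoc]

theorem AlgTensor.add_tmul (a b c : A) :
    AlgTensor.tmul (a + b) c = AlgTensor.tmul a c + AlgTensor.tmul b c :=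
  TensorProduct.add_tmul a b c

theorem AlgTensor.smul_tmul' (r : ℂ) (a b : A) :
    AlgTensor.tmul (r • a) b = r • AlgTensor.tmul a b :=
  TensorProduct.smul_tmul' r a b

theorem AlgTensor.tmul_smul (r : ℂ) (a b : A) :
    AlgTensor.tmul a (r • b) = r • AlgTensor.tmul a b :=
  TensorProduct.tmul_smul r a b

theorem AlgTensor.sum_tmul {κ : Type*} (s : Finset κ) (e : κ → A) (b : A) :
    AlgTensor.tmul (∑ k ∈ s, e k) b = ∑ k ∈ s, AlgTensor.tmul (e k) b :=
  TensorProduct.sum_tmul s e b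

theorem AlgTensor.tmul_sum {κ : Type*} (s : Finset κ) (e : κ → A) (b : A) :
    AlgTensor.tmul b (∑ k ∈ s, e k) = ∑ k ∈ s, AlgTensor.tmul b (e k) :=
  TensorProduct.tmul_sum b s e

/-- The linear map `a ↦ a ⊗ b` into the algebraic tensor product. -/
noncomputable def tmulRightAlg (b : A) : A →ₗ[ℂ] AlgTensor A A where
  toFun a := AlgTensor.tmul a b
  map_add' a c := AlgTensor.add_tmul a c b
  map_smul' r a := AlgTensor.smul_tmul' r a b

/-- The map `a ↦ a ⊗ b` into the projective tensor product. -/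
noncomputable def tmulRight (b : A) : A →L[ℂ] ProjTensor A A :=
  (UniformSpace.Completion.toComplL (𝕜 := ℂ) (E := AlgTensor A A)).comp
    ((tmulRightAlg b).mkContinuous ‖b‖ fun a => (norm_tmul_le a b).trans_eq (mul_comm _ _))

theorem tmulRight_apply (a b : A) :
    tmulRight b a = ((AlgTensor.tmul a b : AlgTensor A A) : ProjTensor A A) := rfl

variable {κ : Type*} [Fintype κ] {e : κ → A} {ε : κ → A → ℂ}

theorem sum_leftAct (hsum : ∑ k, e k = 1) (u : ProjTensor A A) :
    ∑ k, leftAct (e k) u = u := by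
  have := ProjTensor.ext_tmul (S := ∑ k, leftAct (e k)) (T := ContinuousLinearMap.id ℂ _)
    (fun x y => ?_) u
  · simpa [sum_apply] using this
  · rw [sum_apply]
    simp only [leftAct_tmul, ContinuousLinearMap.id_apply]
    have h : ∑ k, AlgTensor.tmul (e k * x) y = AlgTensor.tmul x y := by
      rw [← AlgTensor.sum_tmul, ← Finset.sum_mul, hsum, one_mul]
    rw [← h]
    exact (map_sum (UniformSpace.Completion.toComplL (𝕜 := ℂ) (E := AlgTensor A A)) _ _).symm

/-- Multiplication by `e k` on either side has image in the line through `e k`, so cutting both legs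
down leaves a multiple of `e k ⊗ e k`, and the multiplication map detects the multiple. -/
theorem leftAct_rightAct_idempotent [CompleteSpace A]
    (hl : ∀ k a, e k * a = ε k a • e k) (hr : ∀ k a, a * e k = ε k a • e k)
    (k : κ) (u : ProjTensor A A) :
    leftAct (e k) (rightAct (e k) u) = tmulRight (e k) (e k * mulMap A u) := by
  refine ProjTensor.ext_tmul (S := (leftAct (e k)).comp (rightAct (e k)))
    (T := (tmulRight (e k)).comp ((ContinuousLinearMap.mul ℂ A (e k)).comp (mulMap A)))
    (fun x y => ?_) u
  simp only [ContinuousLinearMap.comp_apply, leftAct_tmul, rightAct_tmul, mulMap_tmul,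
    ContinuousLinearMap.mul_apply', tmulRight_apply]
  congr 1
  rw [hl, hr, ← mul_assoc, hl, smul_mul_assoc, hl, smul_smul, AlgTensor.smul_tmul',
    AlgTensor.tmul_smul, AlgTensor.smul_tmul', smul_smul]

/-- The amenability constant of an algebra with a basis of orthogonal central idempotents is the
norm of its unique diagonal. -/
theorem amenabilityConstant_eq_enorm_diagonal [CompleteSpace A]
    (hl : ∀ k a, e k * a = ε k a • e k) (hr : ∀ k a, a * e k = ε k a • e k)
    (hid : ∀ k, e k * e k = e k) (hsum : ∑ k, e k = 1) :
    amenabilityConstant A = ‖∑ k, AlgTensor.tmul (e k) (e k)‖ₑ := by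
  set M : AlgTensor A A := ∑ k, AlgTensor.tmul (e k) (e k) with hM
  have hMc : (M : ProjTensor A A) = ∑ k, tmulRight (e k) (e k) :=
    map_sum (UniformSpace.Completion.toComplL (𝕜 := ℂ) (E := AlgTensor A A)) _ _
  have hnorm : ‖(M : ProjTensor A A)‖ₑ = ‖M‖ₑ := by
    rw [← ofReal_norm, ← ofReal_norm, UniformSpace.Completion.norm_coe]
  rw [← hnorm]
  -- The tensor `M` is an exact diagonal, so the constant net on one point gives the upper bound.
  refine le_antisymm (sInf_le ⟨PUnit, inferInstance, inferInstance, inferInstance,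
    fun _ => (M : ProjTensor A A), ⟨⟨_, fun _ => le_rfl⟩, fun a => ?_, fun a => ?_⟩, by simp⟩)
    (le_sInf ?_)
  · have h : leftAct a (M : ProjTensor A A) - rightAct a (M : ProjTensor A A) = 0 := by
      rw [sub_eq_zero, hMc, map_sum, map_sum]
      refine Finset.sum_congr rfl fun k _ => ?_
      rw [tmulRight_apply, leftAct_tmul, rightAct_tmul, hl, hr, AlgTensor.smul_tmul',
        AlgTensor.tmul_smul]
    rw [h]
    exact tendsto_const_nhds
  · have h : mulMap A (M : ProjTensor A A) = 1 := by
      rw [hMc, map_sum, ← hsum]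
      refine Finset.sum_congr rfl fun k _ => ?_
      rw [tmulRight_apply, mulMap_tmul, hid]
    rw [h, mul_one]
    exact tendsto_const_nhds
  · rintro c ⟨ι, _, _, _, d, hd, rfl⟩
    -- Write `e·dᵢ = e·(e·dᵢ − dᵢ·e) + e·dᵢ·e`. The first term tends to 0 and the second to `e ⊗ e`;
    -- summing over the idempotents gives the limit of `dᵢ`, whose norm is at most the supremum.
    have key : Filter.Tendsto d Filter.atTop (𝓝 (M : ProjTensor A A)) := by
      have h1 : ∀ k, Filter.Tendsto (fun i => leftAct (e k) (d i)) Filter.atTop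
          (𝓝 (tmulRight (e k) (e k))) := by
        intro k
        have h2 := ((leftAct (e k)).continuous.tendsto 0).comp (hd.commute (e k))
        have h3 := ((tmulRight (e k)).continuous.tendsto (e k)).comp (hd.unit (e k))
        have h4 := h2.add h3
        rw [map_zero, zero_add] at h4
        refine h4.congr fun i => ?_
        simp only [Function.comp_apply]
        rw [map_sub, leftAct_leftAct, hid, leftAct_rightAct_idempotent hl hr, sub_add_cancel]
      have h5 := tendsto_finsetSum Finset.univ fun k _ => h1 k
      rw [← hMc] at h5
      exact h5.congr fun i => sum_leftAct hsum _
    exact le_of_tendsto key.enorm (Filter.Eventually.of_forall fun i => le_iSup (fun i => ‖d i‖ₑ) i)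

/-- The hypotheses say that the norm is the weighted ℓ¹ norm of the coefficients; the families `b`
and `b'` need not be linearly independent. Expanding in `b j ⊗ b' l` bounds the projective norm
above, and a contraction into ℓ¹ of the product index set bounds it below. Two families are allowed
so that the legs can be indexed differently. -/
theorem norm_diagonal_eq {ι ι' : Type*} [Fintype ι] [Fintype ι']
    {β : ι → A →ₗ[ℂ] ℂ} {b : ι → A} {w : ι → ℝ} {β' : ι' → A →ₗ[ℂ] ℂ} {b' : ι' → A} {w' : ι' → ℝ}
    (hw : ∀ j, 0 ≤ w j) (hw' : ∀ j, 0 ≤ w' j)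
    (hb : ∀ a, a = ∑ j, β j a • b j) (hb' : ∀ a, a = ∑ j, β' j a • b' j)
    (hbw : ∀ j, ‖b j‖ ≤ w j) (hbw' : ∀ j, ‖b' j‖ ≤ w' j)
    (hβ : ∀ a, ∑ j, w j * ‖β j a‖ ≤ ‖a‖) (hβ' : ∀ a, ∑ j, w' j * ‖β' j a‖ ≤ ‖a‖) :
    ‖∑ k, AlgTensor.tmul (e k) (e k)‖ =
      ∑ j, ∑ l, w j * w' l * ‖∑ k, β j (e k) * β' l (e k)‖ := by
  apply le_antisymm
  · have h : ∑ k, AlgTensor.tmul (e k) (e k) =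
        ∑ j, ∑ l, (∑ k, β j (e k) * β' l (e k)) • AlgTensor.tmul (b j) (b' l) := by
      simp only [Finset.sum_smul]
      have h1 : ∀ x y, AlgTensor.tmul x y =
          ∑ j, ∑ l, (β j x * β' l y) • AlgTensor.tmul (b j) (b' l) := by
        intro x y
        conv_lhs => rw [hb x, hb' y, AlgTensor.sum_tmul]
        refine Finset.sum_congr rfl fun j _ => ?_
        rw [AlgTensor.tmul_sum]
        refine Finset.sum_congr rfl fun l _ => ?_
        rw [AlgTensor.smul_tmul', AlgTensor.tmul_smul, smul_smul]
      rw [Finset.sum_congr rfl fun k _ => h1 (e k) (e k), Finset.sum_comm]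
      exact Finset.sum_congr rfl fun j _ => Finset.sum_comm
    rw [h]
    refine (norm_sum_le _ _).trans (Finset.sum_le_sum fun j _ =>
      (norm_sum_le _ _).trans (Finset.sum_le_sum fun l _ => ?_))
    rw [norm_smul, mul_comm]
    exact mul_le_mul_of_nonneg_right ((norm_tmul_le _ _).trans
      (mul_le_mul (hbw j) (hbw' l) (norm_nonneg _) (hw j))) (norm_nonneg _)
  -- The coefficient map into ℓ¹, scaled by the weights; `hβ` and `hβ'` make it contractive on
  -- elementary tensors.
  · let T : AlgTensor A A →ₗ[ℂ] PiLp 1 (fun _ : ι × ι' => ℂ) :=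
      (show A ⊗[ℂ] A →ₗ[ℂ] PiLp 1 (fun _ : ι × ι' => ℂ) from
        (WithLp.linearEquiv 1 ℂ (ι × ι' → ℂ)).symm.toLinearMap.comp
          (LinearMap.pi fun p => ((w p.1 * w' p.2 : ℝ) : ℂ) •
            (LinearMap.mul' ℂ ℂ ∘ₗ TensorProduct.map (β p.1) (β' p.2))))
    have hT : ∀ x y p, T (AlgTensor.tmul x y) p =
        ((w p.1 * w' p.2 : ℝ) : ℂ) * (β p.1 x * β' p.2 y) := fun x y p => rfl
    have hnorm : ∀ v : PiLp 1 (fun _ : ι × ι' => ℂ), ‖v‖ = ∑ p, ‖v p‖ := fun v => by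
      simp [PiLp.norm_eq_sum (p := 1) (by simp : 0 < (1 : ℝ≥0∞).toReal)]
    have hle := norm_apply_le_of_tmul T 1 zero_le_one (fun x y => by
      rw [hnorm, one_mul, Fintype.sum_prod_type]
      refine le_trans (le_of_eq ?_) (mul_le_mul (hβ x) (hβ' y)
        (Finset.sum_nonneg fun l _ => mul_nonneg (hw' l) (norm_nonneg _)) (norm_nonneg _))
      rw [Finset.sum_mul_sum]
      refine Finset.sum_congr rfl fun j _ => Finset.sum_congr rfl fun l _ => ?_
      rw [hT, norm_mul, norm_mul, Complex.norm_of_nonneg (mul_nonneg (hw j) (hw' l))]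
      ring) (∑ k, AlgTensor.tmul (e k) (e k))
    rw [one_mul] at hle
    refine le_trans (le_of_eq ?_) hle
    rw [hnorm, Fintype.sum_prod_type]
    refine Finset.sum_congr rfl fun j _ => Finset.sum_congr rfl fun l _ => ?_
    have h2 : T (∑ k, AlgTensor.tmul (e k) (e k)) (j, l) =
        ((w j * w' l : ℝ) : ℂ) * ∑ k, β j (e k) * β' l (e k) := by
      rw [map_sum, WithLp.ofLp_sum, Finset.sum_apply, Finset.mul_sum]
      exact Finset.sum_congr rfl fun k _ => hT _ _ _
    rw [h2, norm_mul, Complex.norm_of_nonneg (mul_nonneg (hw j) (hw' l))]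

end ApproxDiagonal

/-! ### Point masses, the centre and traces of left multiplication -/

section GroupAlgebraBasics

variable {G : Type u} [Group G] [Fintype G]

theorem L1.ext_val {f h : L1 G} (hfh : ∀ x, f.val x = h.val x) : f = h :=
  MonoidAlgebra.coeff_injective (R := ℂ) (M := G) (Finsupp.ext hfh)

variable (G) in
/-- An element of `L¹(G)` is the same as a function on `G`. -/
noncomputable def L1.valEquiv : L1 G ≃ₗ[ℂ] (G → ℂ) where
  toFun f := f.val
  map_add' _ _ := rfl
  map_smul' _ _ := rfl
  invFun f := (MonoidAlgebra.ofCoeff (Finsupp.equivFunOnFinite.symm f) : MonoidAlgebra ℂ G)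
  left_inv _ := L1.ext_val fun _ => rfl
  right_inv _ := rfl

/-- The element of `L¹(G)` with given values. -/
noncomputable def L1.ofFun (f : G → ℂ) : L1 G := (L1.valEquiv G).symm f

theorem L1.val_ofFun (f : G → ℂ) (x : G) : (L1.ofFun f).val x = f x := rfl

theorem L1.val_zero (x : G) : (0 : L1 G).val x = 0 := rfl

theorem L1.val_sum {ι : Type*} (s : Finset ι) (f : ι → L1 G) (x : G) :
    (∑ i ∈ s, f i).val x = ∑ i ∈ s, (f i).val x := by
  have := congrFun (map_sum (L1.valEquiv G) f s) x
  rwa [Finset.sum_apply] at this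

/-- The unit mass at `g`. -/
noncomputable def delta (g : G) : L1 G := MonoidAlgebra.of ℂ G g

theorem val_delta [DecidableEq G] (g x : G) : (delta g).val x = if x = g then 1 else 0 := by
  show (Finsupp.single g (1 : ℂ)) x = _
  rw [Finsupp.single_apply]
  simp [eq_comm]

theorem delta_mul_delta (g h : G) : delta g * delta h = delta (g * h) :=
  ((MonoidAlgebra.of ℂ G).map_mul g h).symm

theorem delta_one : delta (1 : G) = 1 := (MonoidAlgebra.of ℂ G).map_one

theorem val_delta_mul (g : G) (f : L1 G) (x : G) : (delta g * f).val x = f.val (g⁻¹ * x) := by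
  classical
  simp [L1.val_mul, val_delta]

theorem val_mul_delta (g : G) (f : L1 G) (x : G) : (f * delta g).val x = f.val (x * g⁻¹) := by
  classical
  rw [L1.val_mul, Finset.sum_eq_single (x * g⁻¹)]
  · simp [val_delta]
  · intro y _ hy
    rw [val_delta, if_neg, mul_zero]
    rintro rfl
    simp at hy
  · simp

theorem eq_sum_delta (f : L1 G) : f = ∑ g, f.val g • delta g := by
  classical
  refine L1.ext_val fun x => ?_
  simp [L1.val_sum, L1.val_smul, val_delta]

theorem mem_center_iff_val {f : L1 G} :
    f ∈ Subalgebra.center ℂ (L1 G) ↔ ∀ g x : G, f.val (x * g * x⁻¹) = f.val g := by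
  rw [Subalgebra.mem_center_iff]
  constructor
  · intro h g x
    have := congrArg (fun a => L1.val a (x * g)) (h (delta x))
    simpa [val_delta_mul, val_mul_delta] using this.symm
  · intro h a
    refine L1.ext_val fun y => ?_
    rw [L1.val_mul, L1.val_mul, ← Equiv.sum_comp ((Equiv.inv G).trans (Equiv.mulRight y))]
    refine Finset.sum_congr rfl fun x _ => ?_
    simp only [Equiv.trans_apply, Equiv.inv_apply, Equiv.coe_mulRight]
    rw [mul_comm, ← h x y⁻¹]
    simp [mul_assoc]

-- In the basis of point masses, every diagonal entry is the coefficient of `g` in `a * delta g`,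
-- namely `a.val 1`.
open LinearMap in
theorem trace_mulLeft_L1 (a : L1 G) :
    LinearMap.trace ℂ (L1 G) (mulLeft ℂ a) = Fintype.card G * a.val 1 := by
  classical
  rw [trace_eq_matrix_trace ℂ (Module.Basis.ofEquivFun (L1.valEquiv G)), Matrix.trace]
  have h : ∀ g, (toMatrix (Module.Basis.ofEquivFun (L1.valEquiv G))
      (Module.Basis.ofEquivFun (L1.valEquiv G)) (mulLeft ℂ a)).diag g = a.val 1 := by
    intro g
    rw [Matrix.diag_apply, toMatrix_apply, mulLeft_apply, Module.Basis.ofEquivFun_repr_apply,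
      Module.Basis.coe_ofEquivFun]
    have h1 : (L1.valEquiv G).symm (Pi.single g 1) = delta g := by
      refine L1.ext_val fun x => ?_
      rw [val_delta]
      exact Pi.single_apply g 1 x
    show (a * (L1.valEquiv G).symm (Pi.single g 1)).val g = a.val 1
    rw [h1]
    exact (val_mul_delta g a g).trans (by rw [mul_inv_cancel])
  rw [Finset.sum_congr rfl fun g _ => h g]
  simp

-- On the `i`-th factor, left multiplication acts as `B i` on each of the `d i` columns.
open LinearMap in
theorem trace_mulLeft_pi_matrix {ι : Type*} [Fintype ι] {d : ι → ℕ}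
    (B : Π i, Matrix (Fin (d i)) (Fin (d i)) ℂ) :
    LinearMap.trace ℂ (Π i, Matrix (Fin (d i)) (Fin (d i)) ℂ) (mulLeft ℂ B) =
      ∑ i, d i * (B i).trace := by
  classical
  rw [trace_eq_matrix_trace ℂ (Pi.basis fun i => Matrix.stdBasis ℂ (Fin (d i)) (Fin (d i))),
    Matrix.trace, Fintype.sum_sigma]
  refine Finset.sum_congr rfl fun i _ => ?_
  rw [Fintype.sum_prod_type]
  have h : ∀ p q, (toMatrix (Pi.basis fun i => Matrix.stdBasis ℂ (Fin (d i)) (Fin (d i)))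
      (Pi.basis fun i => Matrix.stdBasis ℂ (Fin (d i)) (Fin (d i))) (mulLeft ℂ B)).diag
        ⟨i, (p, q)⟩ = B i p p := by
    intro p q
    rw [Matrix.diag_apply, toMatrix_apply, mulLeft_apply, Pi.basis_repr, Pi.mul_apply,
      Pi.basis_apply, Pi.single_eq_same, Matrix.stdBasis_eq_single]
    have h2 : ∀ M : Matrix (Fin (d i)) (Fin (d i)) ℂ,
        (Matrix.stdBasis ℂ (Fin (d i)) (Fin (d i))).repr M (p, q) = M p q := fun M => rfl
    rw [h2]
    simp
  rw [Finset.sum_congr rfl fun p _ => Finset.sum_congr rfl fun q _ => h p q]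
  simp [Matrix.trace, Finset.mul_sum]

end GroupAlgebraBasics

/-! ### Irreducible characters from the Wedderburn decomposition -/

section Blocks

variable {G : Type u} [Group G] [Fintype G]

variable (G) in
theorem exists_blocks : ∃ (r : ℕ) (d : Fin r → ℕ), (∀ i, NeZero (d i)) ∧
    Nonempty (L1 G ≃ₐ[ℂ] Π i, Matrix (Fin (d i)) (Fin (d i)) ℂ) := by
  have : IsSemisimpleRing (L1 G) := inferInstanceAs (IsSemisimpleRing (MonoidAlgebra ℂ G))
  exact IsSemisimpleRing.exists_algEquiv_pi_matrix_of_isAlgClosed ℂ (L1 G)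

variable {ι : Type} [Fintype ι] [DecidableEq ι] {d : ι → ℕ}
  (φ : L1 G ≃ₐ[ℂ] Π i, Matrix (Fin (d i)) (Fin (d i)) ℂ)

/-- The trace of the action of `a` in the `i`-th irreducible representation. -/
noncomputable def blockTrace (i : ι) (a : L1 G) : ℂ := (φ a i).trace

/-- The irreducible character of the `i`-th block. -/
noncomputable def chr (i : ι) (g : G) : ℂ := blockTrace φ i (delta g)

/-- The central idempotent of the `i`-th block. -/
noncomputable def idem (i : ι) : L1 G := φ.symm (Pi.single i 1)

/-- The central character of the `i`-th block. -/
noncomputable def centralChr (i : ι) (a : L1 G) : ℂ := blockTrace φ i a / d i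

theorem apply_idem (i : ι) : φ (idem φ i) = Pi.single i 1 := φ.apply_symm_apply _

/-- The trace of left multiplication is computed on both sides of `φ`. The coefficients of the block
idempotents, and through them the orthogonality relations, come from this formula. -/
theorem card_mul_val_one (a : L1 G) :
    Fintype.card G * a.val 1 = ∑ i, d i * blockTrace φ i a := by
  rw [← trace_mulLeft_L1, ← LinearMap.trace_conj' _ φ.toLinearEquiv]
  refine Eq.trans ?_ (trace_mulLeft_pi_matrix (φ a))
  congr 1
  refine LinearMap.ext fun B => ?_
  simp [LinearEquiv.conj_apply]

theorem blockTrace_eq_sum (i : ι) (a : L1 G) : blockTrace φ i a = ∑ g, a.val g * chr φ i g := by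
  conv_lhs => rw [eq_sum_delta a]
  simp [blockTrace, chr, map_sum, Finset.sum_apply, Matrix.trace_sum, Matrix.trace_smul]

theorem chr_one (i : ι) : chr φ i 1 = d i := by
  simp [chr, blockTrace, delta_one]

theorem chr_conj (i : ι) (g x : G) : chr φ i (x * g * x⁻¹) = chr φ i g := by
  rw [chr, chr, ← delta_mul_delta, ← delta_mul_delta, blockTrace, blockTrace, map_mul, map_mul,
    Pi.mul_apply, Pi.mul_apply, Matrix.trace_mul_comm, ← mul_assoc, ← Pi.mul_apply, ← map_mul,
    delta_mul_delta, inv_mul_cancel, delta_one, map_one, Pi.one_apply, one_mul]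

/-- Apply `card_mul_val_one` to `idem φ i * delta g⁻¹`, where only block `i` contributes. -/
theorem card_mul_val_idem (i : ι) (g : G) :
    Fintype.card G * (idem φ i).val g = d i * chr φ i g⁻¹ := by
  have h := card_mul_val_one φ (idem φ i * delta g⁻¹)
  rw [val_mul_delta, inv_inv, one_mul] at h
  rw [h, Finset.sum_eq_single i]
  · simp [blockTrace, chr, apply_idem]
  · intro j _ hj
    simp [blockTrace, apply_idem, hj]
  · simp

theorem idem_mul_idem (i j : ι) : idem φ i * idem φ j = if i = j then idem φ i else 0 := by
  apply φ.injective
  rw [map_mul, apply_idem, apply_idem]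
  split_ifs with h
  · subst h; rw [apply_idem, ← Pi.single_mul, one_mul]
  · rw [map_zero]
    funext k
    rw [Pi.mul_apply]
    rcases eq_or_ne k i with rfl | hk
    · simp [h]
    · simp [hk]

theorem sum_idem : ∑ i, idem φ i = 1 := by
  apply φ.injective
  rw [map_sum, map_one, Finset.sum_congr rfl fun i _ => apply_idem φ i]
  exact Finset.univ_sum_single (1 : Π i, Matrix (Fin (d i)) (Fin (d i)) ℂ)

theorem idem_mem_center (i : ι) : idem φ i ∈ Subalgebra.center ℂ (L1 G) := by
  rw [Subalgebra.mem_center_iff]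
  intro b
  apply φ.injective
  rw [map_mul, map_mul, apply_idem]
  funext k
  rw [Pi.mul_apply, Pi.mul_apply]
  rcases eq_or_ne k i with rfl | hk
  · simp
  · simp [hk]

section Central

variable [∀ i, NeZero (d i)]

/-- Schur's lemma: the block of `a` commutes with all matrix units, hence is scalar, and its trace
identifies the scalar. -/
theorem apply_center {a : L1 G} (ha : a ∈ Subalgebra.center ℂ (L1 G)) (i : ι) :
    φ a i = centralChr φ i a • 1 := by
  rw [Subalgebra.mem_center_iff] at ha
  obtain ⟨c, hc⟩ := Matrix.mem_range_scalar_of_commute_single (M := φ a i) fun p q _ => by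
    have h := congrFun (congrArg φ (ha (φ.symm (Pi.single i (Matrix.single p q 1))))) i
    simpa [Commute, SemiconjBy] using h
  have hd : (d i : ℂ) ≠ 0 := Nat.cast_ne_zero.2 (NeZero.ne _)
  have hc' : φ a i = c • 1 := by rw [← hc, Matrix.scalar_apply, Matrix.smul_one_eq_diagonal]
  rw [centralChr, blockTrace, hc']
  simp [hd]

theorem idem_mul {a : L1 G} (ha : a ∈ Subalgebra.center ℂ (L1 G)) (i : ι) :
    idem φ i * a = centralChr φ i a • idem φ i := by
  apply φ.injective
  rw [map_mul, map_smul, apply_idem]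
  funext k
  rw [Pi.mul_apply, Pi.smul_apply]
  rcases eq_or_ne k i with rfl | hk
  · simp [apply_center φ ha]
  · simp [hk]

theorem mul_idem {a : L1 G} (ha : a ∈ Subalgebra.center ℂ (L1 G)) (i : ι) :
    a * idem φ i = centralChr φ i a • idem φ i := by
  rw [Subalgebra.mem_center_iff.1 (idem_mem_center φ i), idem_mul φ ha]

theorem eq_sum_idem {a : L1 G} (ha : a ∈ Subalgebra.center ℂ (L1 G)) :
    a = ∑ i, centralChr φ i a • idem φ i := by
  conv_lhs => rw [← mul_one a, ← sum_idem φ, Finset.mul_sum]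
  exact Finset.sum_congr rfl fun i _ => mul_idem φ ha i

theorem card_ne_zero : (Fintype.card G : ℂ) ≠ 0 := Nat.cast_ne_zero.2 Fintype.card_ne_zero

theorem val_idem (i : ι) (g : G) :
    (idem φ i).val g = d i * chr φ i g⁻¹ / Fintype.card G := by
  rw [← card_mul_val_idem, mul_div_cancel_left₀ _ card_ne_zero]

theorem val_idem_one (i : ι) : (idem φ i).val 1 = (d i : ℂ) ^ 2 / Fintype.card G := by
  rw [val_idem, inv_one, chr_one, sq]

theorem idem_ne_zero (i : ι) : idem φ i ≠ 0 := by
  intro h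
  have h1 := val_idem_one φ i
  rw [h, L1.val_zero, eq_comm, div_eq_zero_iff] at h1
  have hd : (d i : ℂ) ≠ 0 := Nat.cast_ne_zero.2 (NeZero.ne _)
  simp [hd] at h1

/-- Row orthogonality: the trace of `idem φ i` in block `j` is known, and the coefficients of `idem
φ i` are values of the `i`-th character. -/
theorem sum_chr_inv_mul_chr (i j : ι) :
    ∑ g, chr φ i g⁻¹ * chr φ j g = if i = j then (Fintype.card G : ℂ) else 0 := by
  have hd : (d i : ℂ) ≠ 0 := Nat.cast_ne_zero.2 (NeZero.ne _)
  have h := blockTrace_eq_sum φ j (idem φ i)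
  simp only [val_idem] at h
  have h2 : ∑ g, d i * chr φ i g⁻¹ / Fintype.card G * chr φ j g =
      d i / Fintype.card G * ∑ g, chr φ i g⁻¹ * chr φ j g := by
    rw [Finset.mul_sum]
    exact Finset.sum_congr rfl fun g _ => by ring
  have h3 : blockTrace φ j (idem φ i) = if i = j then (d i : ℂ) else 0 := by
    rw [blockTrace, apply_idem]
    split_ifs with hij
    · subst hij; simp
    · simp [Ne.symm hij]
  rw [h2, h3] at h
  have hn := card_ne_zero (G := G)
  split_ifs at h ⊢ with hij
  · field_simp at h
    exact h.symm
  · rcases mul_eq_zero.1 h.symm with h | h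
    · simp [hd] at h
    · exact h

/-- The star operation of `L¹(G)`. -/
noncomputable def L1.conjStar (f : L1 G) : L1 G := L1.ofFun fun g => star (f.val g⁻¹)

theorem L1.conjStar_conjStar (f : L1 G) : f.conjStar.conjStar = f := by
  refine L1.ext_val fun x => ?_
  simp [L1.conjStar, L1.val_ofFun]

theorem L1.conjStar_mul (f h : L1 G) : (f * h).conjStar = h.conjStar * f.conjStar := by
  refine L1.ext_val fun x => ?_
  simp only [L1.conjStar, L1.val_ofFun, L1.val_mul, star_sum]
  rw [← Equiv.sum_comp (Equiv.mulLeft x⁻¹)]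
  refine Finset.sum_congr rfl fun y _ => ?_
  simp only [Equiv.coe_mulLeft]
  rw [star_mul']
  simp [mul_comm]

theorem L1.conjStar_mem_center {f : L1 G} (hf : f ∈ Subalgebra.center ℂ (L1 G)) :
    f.conjStar ∈ Subalgebra.center ℂ (L1 G) := by
  rw [mem_center_iff_val] at hf ⊢
  intro g x
  simp only [L1.conjStar, L1.val_ofFun]
  rw [← hf g⁻¹ x]
  simp [mul_assoc]

theorem idem_mul_eq_or {a : L1 G} (ha : a ∈ Subalgebra.center ℂ (L1 G)) (haa : a * a = a)
    (i : ι) : idem φ i * a = 0 ∨ idem φ i * a = idem φ i := by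
  have h : idem φ i * a * a = idem φ i * a := by rw [mul_assoc, haa]
  rw [idem_mul φ ha, smul_mul_assoc, idem_mul φ ha, smul_smul, ← sub_eq_zero, ← sub_smul,
    smul_eq_zero, or_iff_left (idem_ne_zero φ i)] at h
  rw [idem_mul φ ha]
  have h' : centralChr φ i a * (centralChr φ i a - 1) = 0 := by linear_combination h
  rcases mul_eq_zero.1 h' with h | h
  · left; rw [h, zero_smul]
  · right; rw [sub_eq_zero.1 h, one_smul]

/-- This replaces unitarity of the representations. The star of `e = idem φ i` is a central
idempotent and `e e* ≠ 0`; minimality of `e` among central idempotents gives `e e* = e`, which is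
self-adjoint. -/
theorem conjStar_idem (i : ι) : (idem φ i).conjStar = idem φ i := by
  have hc := L1.conjStar_mem_center (idem_mem_center φ i)
  have hid : (idem φ i).conjStar * (idem φ i).conjStar = (idem φ i).conjStar := by
    rw [← L1.conjStar_mul, idem_mul_idem, if_pos rfl]
  -- The value of `e e*` at 1 is the sum of the `|e(g)|²`.
  have hne : idem φ i * (idem φ i).conjStar ≠ 0 := by
    intro h
    have h1 := congrArg (fun f => L1.val f 1) h
    simp only [L1.val_mul, L1.val_zero, L1.conjStar, L1.val_ofFun, mul_one, inv_inv,
      Complex.star_def, Complex.mul_conj, Complex.normSq_eq_norm_sq] at h1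
    rw [← Complex.ofReal_sum, Complex.ofReal_eq_zero,
      Finset.sum_eq_zero_iff_of_nonneg fun _ _ => by positivity] at h1
    refine idem_ne_zero φ i (L1.ext_val fun x => ?_)
    rw [L1.val_zero]
    simpa using h1 x (Finset.mem_univ x)
  have h1 := (idem_mul_eq_or φ hc hid i).resolve_left hne
  have h2 := congrArg L1.conjStar h1
  rw [L1.conjStar_mul, L1.conjStar_conjStar] at h2
  rw [← h2, h1]

theorem star_chr (i : ι) (g : G) : star (chr φ i g) = chr φ i g⁻¹ := by
  have hd : (d i : ℂ) ≠ 0 := Nat.cast_ne_zero.2 (NeZero.ne _)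
  have hn := card_ne_zero (G := G)
  have h := congrArg (fun f => L1.val f g) (conjStar_idem φ i)
  simp only [L1.conjStar, L1.val_ofFun, val_idem, inv_inv] at h
  rw [star_div₀, star_mul', star_natCast, star_natCast] at h
  field_simp at h
  exact h

open Classical in
/-- Column orthogonality. -/
theorem sum_chr_mul_chr_inv (g h : G) :
    ∑ i, chr φ i g * chr φ i h⁻¹ =
      if IsConj g h then (Fintype.card G : ℂ) / Nat.card (ConjClasses.mk g).carrier else 0 := by
  -- Expand the class sum of `g` in the central idempotents and compare coefficients at `h`.
  set K : L1 G := L1.ofFun fun x => if IsConj g x then 1 else 0 with hK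
  have hKc : K ∈ Subalgebra.center ℂ (L1 G) := by
    rw [mem_center_iff_val]
    intro y x
    simp only [hK, L1.val_ofFun]
    have : IsConj (x * y * x⁻¹) y := (isConj_iff.2 ⟨x, rfl⟩).symm
    exact if_congr ⟨fun h => h.trans this, fun h => h.trans this.symm⟩ rfl rfl
  have hcarrier : ∀ x, x ∈ (ConjClasses.mk g).carrier ↔ IsConj g x := fun x => by
    rw [ConjClasses.mem_carrier_iff_mk_eq, ConjClasses.mk_eq_mk_iff_isConj]
    exact ⟨IsConj.symm, IsConj.symm⟩
  set N : ℂ := ((Nat.card (ConjClasses.mk g).carrier : ℕ) : ℂ) with hN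
  have hN0 : N ≠ 0 := by
    rw [hN, Nat.cast_ne_zero]
    have : Nonempty (ConjClasses.mk g).carrier := ⟨⟨g, ConjClasses.mem_carrier_mk⟩⟩
    exact Nat.card_pos.ne'
  have hKt : ∀ i, blockTrace φ i K = N * chr φ i g := by
    intro i
    rw [blockTrace_eq_sum]
    have h1 : ∀ x, K.val x * chr φ i x = if IsConj g x then chr φ i g else 0 := by
      intro x
      simp only [hK, L1.val_ofFun]
      split_ifs with hx
      · obtain ⟨c, rfl⟩ := isConj_iff.1 hx
        rw [chr_conj, one_mul]
      · simp
    rw [Finset.sum_congr rfl fun x _ => h1 x, ← Finset.sum_filter, Finset.sum_const, nsmul_eq_mul,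
      hN]
    congr 2
    rw [Nat.card_eq_fintype_card, Fintype.card_subtype]
    congr 1
    ext x
    simp [hcarrier]
  have h1 := congrArg (fun f => L1.val f h) (eq_sum_idem φ hKc)
  simp only [L1.val_sum, L1.val_smul, centralChr, hKt, val_idem] at h1
  rw [hK, L1.val_ofFun] at h1
  have h2 : ∑ i, N * chr φ i g / d i * (d i * chr φ i h⁻¹ / Fintype.card G) =
      N / Fintype.card G * ∑ i, chr φ i g * chr φ i h⁻¹ := by
    rw [Finset.mul_sum]
    refine Finset.sum_congr rfl fun i _ => ?_
    have hd : (d i : ℂ) ≠ 0 := Nat.cast_ne_zero.2 (NeZero.ne _)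
    field_simp
  rw [h2] at h1
  have hn := card_ne_zero (G := G)
  split_ifs at h1 ⊢ with hgh
  · field_simp at h1 ⊢
    linear_combination -h1
  · have : N / Fintype.card G ≠ 0 := div_ne_zero hN0 hn
    exact (mul_eq_zero.1 h1.symm).resolve_left this

end Central

end Blocks

/-! ### Sizes of conjugacy classes -/

section ClassSize

variable {G : Type u} [Group G] [Fintype G]

/-- The size of the conjugacy class of `g`. -/
noncomputable def classSize (g : G) : ℕ := Nat.card (ConjClasses.mk g).carrier

theorem classSize_pos (g : G) : 0 < classSize g := by
  have : Nonempty (ConjClasses.mk g).carrier := ⟨⟨g, ConjClasses.mem_carrier_mk⟩⟩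
  exact Nat.card_pos

theorem classSize_eq_of_isConj {g h : G} (hgh : IsConj g h) : classSize g = classSize h := by
  rw [classSize, classSize, ConjClasses.mk_eq_mk_iff_isConj.2 hgh]

open Classical in
theorem card_filter_isConj (g : G) : (Finset.univ.filter fun x => IsConj g x).card =
    classSize g := by
  rw [classSize, Nat.card_eq_fintype_card, Fintype.card_subtype]
  congr 1
  ext x
  rw [Finset.mem_filter, Finset.mem_filter, ConjClasses.mem_carrier_iff_mk_eq,
    ConjClasses.mk_eq_mk_iff_isConj, isConj_comm]

open Classical in
theorem sum_ite_isConj {M : Type*} [AddCommMonoid M] (g : G) {F : G → M}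
    (hF : ∀ g x : G, F (x * g * x⁻¹) = F g) :
    (∑ x, if IsConj g x then F x else 0) = classSize g • F g := by
  have h1 : ∀ x, (if IsConj g x then F x else 0) = if IsConj g x then F g else 0 := by
    intro x
    split_ifs with hx
    · obtain ⟨c, rfl⟩ := isConj_iff.1 hx
      rw [hF]
    · rfl
  rw [Finset.sum_congr rfl fun x _ => h1 x, ← Finset.sum_filter, Finset.sum_const,
    card_filter_isConj]

end ClassSize

/-! ### The amenability constant of the centre of the group algebra -/

section CentreOfGroupAlgebra

variable {G : Type u} [Group G] [Fintype G]

open Classical in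
/-- The normalised indicator function of the conjugacy class of `g`, in `ZL¹(G)`. -/
noncomputable def classMean (g : G) : ZL1 G :=
  ⟨L1.ofFun fun x => if IsConj g x then (classSize g : ℂ)⁻¹ else 0, by
    rw [mem_center_iff_val]
    intro y x
    simp only [L1.val_ofFun]
    have : IsConj (x * y * x⁻¹) y := (isConj_iff.2 ⟨x, rfl⟩).symm
    exact if_congr ⟨fun h => h.trans this, fun h => h.trans this.symm⟩ rfl rfl⟩

theorem norm_classMean_le (g : G) : ‖classMean g‖ ≤ 1 := by
  classical
  have hpos : (classSize g : ℝ) ≠ 0 := Nat.cast_ne_zero.2 (classSize_pos g).ne'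
  have h : ‖classMean g‖ = ∑ x, if IsConj g x then (classSize g : ℝ)⁻¹ else 0 := by
    refine (L1.norm_def _).trans (Finset.sum_congr rfl fun x _ => ?_)
    show ‖(if IsConj g x then (classSize g : ℂ)⁻¹ else 0)‖ = _
    split_ifs <;> simp
  rw [h, sum_ite_isConj (F := fun _ => (classSize g : ℝ)⁻¹) g fun _ _ => rfl, nsmul_eq_mul,
    mul_inv_cancel₀ hpos]

/-- Evaluation at `g` on `ZL¹(G)`. -/
noncomputable def evalZL1 (g : G) : ZL1 G →ₗ[ℂ] ℂ :=
  (LinearMap.proj g).comp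
    ((L1.valEquiv G).toLinearMap.comp (Subalgebra.center ℂ (L1 G)).toSubmodule.subtype)

theorem evalZL1_apply (g : G) (a : ZL1 G) : evalZL1 g a = (a : L1 G).val g := rfl

/-- The sum runs over elements, not classes: a class is counted once for each of its elements, which
the normalisation by `classSize` compensates. -/
theorem eq_sum_classMean (a : ZL1 G) : a = ∑ g, evalZL1 g a • classMean g := by
  classical
  refine Subtype.ext (L1.ext_val fun x => ?_)
  rw [← evalZL1_apply, ← evalZL1_apply, map_sum]
  have h : ∀ g, evalZL1 x (evalZL1 g a • classMean g) =
      if IsConj x g then evalZL1 g a * (classSize x : ℂ)⁻¹ else 0 := by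
    intro g
    rw [map_smul, evalZL1_apply x (classMean g), classMean, L1.val_ofFun, smul_eq_mul]
    by_cases hg : IsConj x g
    · rw [if_pos hg, if_pos hg.symm, classSize_eq_of_isConj hg]
    · rw [if_neg hg, if_neg fun h => hg h.symm, mul_zero]
  have ha := mem_center_iff_val.1 a.2
  have hpos : (classSize x : ℂ) ≠ 0 := Nat.cast_ne_zero.2 (classSize_pos x).ne'
  rw [Finset.sum_congr rfl fun g _ => h g,
    sum_ite_isConj (F := fun g => evalZL1 g a * (classSize x : ℂ)⁻¹) x fun g y => by
      rw [evalZL1_apply, evalZL1_apply, ha], nsmul_eq_mul]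
  field_simp

variable {ι : Type} [Fintype ι] [DecidableEq ι] {d : ι → ℕ} [∀ i, NeZero (d i)]
  (φ : L1 G ≃ₐ[ℂ] Π i, Matrix (Fin (d i)) (Fin (d i)) ℂ)

/-- The L¹ norm is the ℓ¹ norm of the values, so all weights are 1. The first leg is indexed through
`g⁻¹` to produce `chr φ i g * chr φ i h⁻¹`, the form needed for column orthogonality. -/
theorem amenabilityConstant_ZL1 :
    amenabilityConstant (ZL1 G) = ENNReal.ofReal ((∑ g : G, ∑ h : G,
      ‖∑ i, (d i : ℂ) ^ 2 * (chr φ i g * chr φ i h⁻¹)‖) / (Fintype.card G : ℝ) ^ 2) := by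
  let e : ι → ZL1 G := fun i => ⟨idem φ i, idem_mem_center φ i⟩
  rw [amenabilityConstant_eq_enorm_diagonal (e := e) (ε := fun i a => centralChr φ i (a : L1 G))
    (fun k a => Subtype.ext (idem_mul φ a.2 k)) (fun k a => Subtype.ext (mul_idem φ a.2 k))
    (fun k => Subtype.ext ((idem_mul_idem φ k k).trans (if_pos rfl)))
    (Subtype.ext ((map_sum (Subalgebra.center ℂ (L1 G)).val e Finset.univ).trans (sum_idem φ))),
    ← ofReal_norm]
  have hn : ∀ a : ZL1 G, ∑ g, ‖evalZL1 g a‖ = ‖a‖ := fun a => rfl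
  have hn' : ∀ a : ZL1 G, ∑ g : G, ‖evalZL1 g⁻¹ a‖ = ‖a‖ := fun a => by
    rw [← hn]
    exact Equiv.sum_comp (Equiv.inv G) fun g => ‖evalZL1 g a‖
  rw [norm_diagonal_eq (e := e) (β := fun g : G => evalZL1 g⁻¹) (b := fun g : G => classMean g⁻¹)
    (w := fun _ => 1) (β' := fun g : G => evalZL1 g) (b' := fun g : G => classMean g)
    (w' := fun _ => 1) (fun _ => zero_le_one) (fun _ => zero_le_one)
    (fun a => (eq_sum_classMean a).trans
      (Equiv.sum_comp (Equiv.inv G) fun g => evalZL1 g a • classMean g).symm)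
    eq_sum_classMean (fun g => norm_classMean_le g⁻¹) norm_classMean_le
    (fun a => by simp [hn']) (fun a => by simp [hn])]
  congr 1
  rw [Finset.sum_div]
  refine Finset.sum_congr rfl fun g _ => ?_
  rw [Finset.sum_div]
  refine Finset.sum_congr rfl fun h _ => ?_
  have h1 : ∑ i, evalZL1 g⁻¹ (e i) * evalZL1 h (e i) =
      (∑ i, (d i : ℂ) ^ 2 * (chr φ i g * chr φ i h⁻¹)) / (Fintype.card G : ℂ) ^ 2 := by
    rw [Finset.sum_div]
    refine Finset.sum_congr rfl fun i _ => ?_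
    rw [evalZL1_apply, evalZL1_apply, val_idem, val_idem, inv_inv]
    ring
  rw [h1, norm_div]
  simp

end CentreOfGroupAlgebra

/-! ### The Fourier norm and Fourier coefficients -/

section FourierNorm

variable {G : Type u} [Group G] [Fintype G]

/-- Complex conjugation is an isometry of ℓ² that intertwines `leftReg c` and `leftReg (star c)`. -/
theorem norm_leftReg_star_le (c : G → ℂ) : ‖leftReg (star c)‖ ≤ ‖leftReg c‖ := by
  have hst : ∀ ξ : EuclideanSpace ℂ G,
      ‖(WithLp.toLp 2 fun x => star (ξ x) : EuclideanSpace ℂ G)‖ = ‖ξ‖ := fun ξ => by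
    simp [EuclideanSpace.norm_eq]
  refine ContinuousLinearMap.opNorm_le_bound _ (norm_nonneg _) fun ξ => ?_
  have h : leftReg (star c) ξ = WithLp.toLp 2 fun x => star
      (leftReg c (WithLp.toLp 2 fun x => star (ξ x) : EuclideanSpace ℂ G) x) := by
    ext x
    simp [leftReg_apply]
  rw [h, hst, ← hst ξ]
  exact ContinuousLinearMap.le_opNorm _ _

/-- The pointwise complex conjugate of an element of `A(G)`. -/
def fourierStar (f : FourierAlgebra G) : FourierAlgebra G := fun g => star (f g)

theorem fourierNorm_fourierStar_le (f : FourierAlgebra G) : ‖fourierStar f‖ ≤ ‖f‖ := by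
  refine fourierNorm_le (fourierNorm_nonneg f) fun c => ?_
  have h : pairing (fourierStar f) c = star (pairing f (star c)) := by
    simp [pairing, fourierStar]
  rw [h, norm_star]
  exact (norm_pairing_le f _).trans
    (mul_le_mul_of_nonneg_left (norm_leftReg_star_le c) (fourierNorm_nonneg f))

/-- An element of `L¹(G)` as a vector of `ℓ²(G)`. -/
noncomputable def L1.toEuclidean (f : L1 G) : EuclideanSpace ℂ G := WithLp.toLp 2 f.val

theorem leftReg_toEuclidean (c : G → ℂ) (f : L1 G) :
    leftReg c f.toEuclidean = (L1.ofFun c * f).toEuclidean := by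
  ext x
  rw [leftReg_apply]
  exact (L1.val_mul (L1.ofFun c) f x).symm

theorem inner_toEuclidean (f h : L1 G) :
    inner ℂ (L1.toEuclidean f) (L1.toEuclidean h) = (f.conjStar * h).val 1 := by
  rw [L1.val_mul, PiLp.inner_apply, ← Equiv.sum_comp (Equiv.inv G)]
  refine Finset.sum_congr rfl fun x _ => ?_
  simp [L1.toEuclidean, L1.conjStar, L1.val_ofFun, mul_comm]

theorem norm_toEuclidean_sq (f : L1 G) :
    ((‖f.toEuclidean‖ ^ 2 : ℝ) : ℂ) = (f.conjStar * f).val 1 := by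
  rw [← inner_toEuclidean, inner_self_eq_norm_sq_to_K]
  simp

variable {ι : Type} [Fintype ι] [DecidableEq ι] {d : ι → ℕ} [∀ i, NeZero (d i)]
  (φ : L1 G ≃ₐ[ℂ] Π i, Matrix (Fin (d i)) (Fin (d i)) ℂ)

/-- Up to the factor `d i / |G|`, the character is the coefficient function of the regular
representation at the vector `idem φ i`, whose squared norm is `(d i)² / |G|`. -/
theorem norm_pairing_chr_le (i : ι) (c : G → ℂ) :
    ‖pairing (chr φ i) c‖ ≤ d i * ‖leftReg c‖ := by
  have hd : (0 : ℝ) < d i := Nat.cast_pos.2 (NeZero.pos _)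
  have hn : (0 : ℝ) < Fintype.card G := Nat.cast_pos.2 Fintype.card_pos
  set v := (idem φ i).toEuclidean with hv
  have h1 : ‖v‖ ^ 2 = (d i : ℝ) ^ 2 / Fintype.card G := by
    have := norm_toEuclidean_sq (idem φ i)
    rw [conjStar_idem, idem_mul_idem, if_pos rfl, val_idem_one] at this
    rw [← hv] at this
    apply Complex.ofReal_injective
    rw [this]
    push_cast
    rfl
  have h2 : inner ℂ v (leftReg c v) = d i / Fintype.card G * pairing (chr φ i) c := by
    rw [hv, leftReg_toEuclidean, inner_toEuclidean, conjStar_idem, ← mul_assoc,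
      ← Subalgebra.mem_center_iff.1 (idem_mem_center φ i), mul_assoc, idem_mul_idem, if_pos rfl,
      L1.val_mul, pairing, Finset.mul_sum]
    refine Finset.sum_congr rfl fun g _ => ?_
    rw [L1.val_ofFun, val_idem, mul_one, inv_inv]
    ring
  have h3 : ‖inner ℂ v (leftReg c v)‖ ≤ ‖leftReg c‖ * ‖v‖ ^ 2 := by
    refine (norm_inner_le_norm _ _).trans ?_
    rw [sq, ← mul_assoc, mul_comm (‖leftReg c‖ * _)]
    exact mul_le_mul_of_nonneg_left ((leftReg c).le_opNorm v) (norm_nonneg _)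
  rw [h2, h1, norm_mul, norm_div, Complex.norm_natCast, Complex.norm_natCast] at h3
  have h4 : (d i : ℝ) / Fintype.card G * ‖pairing (chr φ i) c‖ ≤
      (d i : ℝ) / Fintype.card G * (d i * ‖leftReg c‖) := h3.trans_eq (by ring)
  exact le_of_mul_le_mul_left h4 (div_pos hd hn)

/-- The Fourier coefficient of `f` at the character `χᵢ`. -/
noncomputable def fourierCoeff (i : ι) (f : G → ℂ) : ℂ :=
  (∑ g, f g * chr φ i g⁻¹) / Fintype.card G

/-- A combination `c` of block idempotents with unimodular coefficients satisfies `c* c = 1`, so it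
acts isometrically. -/
theorem norm_leftReg_le_one_of_phase {u : ι → ℂ} (hu : ∀ i, star (u i) * u i = 1) :
    ‖leftReg (∑ i, u i • idem φ i).val‖ ≤ 1 := by
  refine ContinuousLinearMap.opNorm_le_bound _ zero_le_one fun ξ => ?_
  rw [one_mul]
  set c := ∑ i, u i • idem φ i with hc
  have hstar : c.conjStar = ∑ i, star (u i) • idem φ i := by
    refine L1.ext_val fun x => ?_
    simp only [L1.conjStar, L1.val_ofFun, hc, L1.val_sum, L1.val_smul, star_sum, star_mul']
    refine Finset.sum_congr rfl fun i _ => ?_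
    congr 1
    exact congrArg (fun f => L1.val f x) (conjStar_idem φ i)
  have hcc : c.conjStar * c = 1 := by
    rw [hstar, hc, Finset.sum_mul_sum, ← sum_idem φ]
    refine Finset.sum_congr rfl fun i _ => ?_
    rw [Finset.sum_eq_single i]
    · rw [smul_mul_smul_comm, hu, idem_mul_idem, if_pos rfl, one_smul]
    · intro j _ hj
      rw [smul_mul_smul_comm, idem_mul_idem, if_neg hj.symm, smul_zero]
    · simp
  have hξ : ξ = (L1.ofFun ξ.ofLp).toEuclidean := rfl
  have h1 : ((‖leftReg c.val ξ‖ ^ 2 : ℝ) : ℂ) = ((‖ξ‖ ^ 2 : ℝ) : ℂ) := by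
    rw [hξ, leftReg_toEuclidean, norm_toEuclidean_sq, norm_toEuclidean_sq, L1.conjStar_mul,
      show L1.ofFun c.val = c from (L1.valEquiv G).symm_apply_apply c, mul_assoc, ← mul_assoc c.conjStar, hcc, one_mul]
  rw [Complex.ofReal_inj] at h1
  exact ((sq_eq_sq₀ (norm_nonneg _) (norm_nonneg _)).1 h1).le

/-- Pair `f` with the combination of block idempotents whose phases cancel those of the Fourier
coefficients. Together with `norm_chrZA_le` this makes the norm of `ZA G` a weighted ℓ¹ norm. -/
theorem sum_mul_norm_fourierCoeff_le (f : FourierAlgebra G) :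
    ∑ i, d i * ‖fourierCoeff φ i f‖ ≤ ‖f‖ := by
  have hex : ∀ z : ℂ, ∃ w : ℂ, star w * w = 1 ∧ w * z = ‖z‖ := by
    intro z
    rcases eq_or_ne z 0 with rfl | hz
    · exact ⟨1, by simp, by simp⟩
    · have hz' : (‖z‖ : ℂ) ≠ 0 := by simpa using hz
      have h : star z * z = (‖z‖ : ℂ) ^ 2 := by
        rw [mul_comm, Complex.star_def, Complex.mul_conj, Complex.normSq_eq_norm_sq]
        push_cast
        rfl
      refine ⟨star z / ‖z‖, ?_, ?_⟩
      · have hr : star (‖z‖ : ℂ) = ‖z‖ := Complex.conj_ofReal _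
        rw [star_div₀, star_star, hr, div_mul_div_comm, mul_comm z, h, sq,
          div_self (mul_ne_zero hz' hz')]
      · field_simp
        exact h
  choose u hu hu' using fun i => hex (fourierCoeff φ i f)
  have h1 := norm_pairing_le f (∑ i, u i • idem φ i).val
  have h2 : pairing f (∑ i, u i • idem φ i).val =
      ((∑ i, d i * ‖fourierCoeff φ i f‖ : ℝ) : ℂ) := by
    push_cast
    have h3 : ∀ i, (d i : ℂ) * ‖fourierCoeff φ i f‖ = ∑ g, f g * (u i * (idem φ i).val g) := by
      intro i
      have h4 : fourierCoeff φ i f = (∑ g, f g * chr φ i g⁻¹) / Fintype.card G := rfl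
      rw [← hu' i, h4, Finset.sum_div, Finset.mul_sum, Finset.mul_sum]
      refine Finset.sum_congr rfl fun g _ => ?_
      rw [val_idem]
      ring
    rw [Finset.sum_congr rfl fun i _ => h3 i, Finset.sum_comm]
    refine Finset.sum_congr rfl fun g _ => ?_
    rw [← Finset.mul_sum, L1.val_sum]
    rfl
  rw [h2, Complex.norm_of_nonneg (Finset.sum_nonneg fun i _ => by positivity)] at h1
  exact h1.trans (mul_le_of_le_one_right (fourierNorm_nonneg f)
    (norm_leftReg_le_one_of_phase φ hu))

/-- Exchange the sums and apply column orthogonality; as `f` is a class function, the class of `x`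
contributes `classSize x` equal terms. -/
theorem fourier_inversion {f : G → ℂ} (hf : ∀ g x : G, f (x * g * x⁻¹) = f g) (x : G) :
    f x = ∑ i, fourierCoeff φ i f * chr φ i x := by
  classical
  have hn := card_ne_zero (G := G)
  have h1 : ∑ i, fourierCoeff φ i f * chr φ i x =
      (∑ g, f g * ∑ i, chr φ i x * chr φ i g⁻¹) / Fintype.card G := by
    simp only [fourierCoeff, Finset.mul_sum, Finset.sum_div, Finset.sum_mul]
    rw [Finset.sum_comm]
    exact Finset.sum_congr rfl fun g _ => Finset.sum_congr rfl fun i _ => by ring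
  have h2 : ∀ g, f g * ∑ i, chr φ i x * chr φ i g⁻¹ =
      if IsConj x g then f g * (Fintype.card G / classSize x) else 0 := by
    intro g
    rw [sum_chr_mul_chr_inv, mul_ite, mul_zero]
    rfl
  have hpos : (classSize x : ℂ) ≠ 0 := Nat.cast_ne_zero.2 (classSize_pos x).ne'
  rw [h1, Finset.sum_congr rfl fun g _ => h2 g,
    sum_ite_isConj (F := fun g => f g * (Fintype.card G / classSize x : ℂ)) x fun g y => by
      rw [hf], nsmul_eq_mul]
  field_simp

end FourierNorm

/-! ### The amenability constant of the central Fourier algebra -/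

section CentralFourierAlgebra

variable {G : Type u} [Group G] [Fintype G]

/-- Evaluation at `g` on `ZA(G)`. -/
noncomputable def evalZA (g : G) : ZA G →ₗ[ℂ] ℂ :=
  (LinearMap.proj (φ := fun _ : G => ℂ) g).comp (classFunctions G).toSubmodule.subtype

theorem evalZA_apply (g : G) (a : ZA G) : evalZA g a = (a : FourierAlgebra G) g := rfl

theorem ZA.ext_eval {a b : ZA G} (h : ∀ g, evalZA g a = evalZA g b) : a = b :=
  Subtype.ext (funext h)

theorem evalZA_mul (g : G) (a b : ZA G) : evalZA g (a * b) = evalZA g a * evalZA g b := rfl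

theorem evalZA_conj (a : ZA G) (g x : G) : evalZA (x * g * x⁻¹) a = evalZA g a := a.2 g x

open Classical in
/-- The indicator function of a conjugacy class, in `ZA(G)`. -/
noncomputable def classInd (C : ConjClasses G) : ZA G :=
  ⟨fun x => if ConjClasses.mk x = C then 1 else 0, fun g x => by
    have : ConjClasses.mk (x * g * x⁻¹) = ConjClasses.mk g :=
      ConjClasses.mk_eq_mk_iff_isConj.2 (isConj_iff.2 ⟨x, rfl⟩).symm
    exact if_congr (by rw [this]) rfl rfl⟩

open Classical in
theorem evalZA_classInd (C : ConjClasses G) (x : G) :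
    evalZA x (classInd C) = if ConjClasses.mk x = C then 1 else 0 := rfl

variable {ι : Type} [Fintype ι] [DecidableEq ι] {d : ι → ℕ} [∀ i, NeZero (d i)]
  (φ : L1 G ≃ₐ[ℂ] Π i, Matrix (Fin (d i)) (Fin (d i)) ℂ)

/-- The irreducible character `χᵢ` as an element of `ZA(G)`. -/
noncomputable def chrZA (i : ι) : ZA G := ⟨chr φ i, chr_conj φ i⟩

/-- The conjugate of the irreducible character `χᵢ` as an element of `ZA(G)`. -/
noncomputable def chrStarZA (i : ι) : ZA G :=
  ⟨fourierStar (chr φ i), fun g x => congrArg star (chr_conj φ i g x)⟩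

theorem norm_chrZA_le (i : ι) : ‖chrZA φ i‖ ≤ d i :=
  fourierNorm_le (Nat.cast_nonneg _) (norm_pairing_chr_le φ i)

theorem norm_chrStarZA_le (i : ι) : ‖chrStarZA φ i‖ ≤ d i :=
  (fourierNorm_fourierStar_le (chr φ i)).trans (norm_chrZA_le φ i)

/-- The Fourier coefficient at `χᵢ` as a functional on `ZA(G)`. -/
noncomputable def coeffZA (i : ι) : ZA G →ₗ[ℂ] ℂ :=
  (Fintype.card G : ℂ)⁻¹ • ∑ g, chr φ i g⁻¹ • evalZA g

/-- The Fourier coefficient at the conjugate of `χᵢ` as a functional on `ZA(G)`. -/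
noncomputable def coeffStarZA (i : ι) : ZA G →ₗ[ℂ] ℂ :=
  (Fintype.card G : ℂ)⁻¹ • ∑ g, chr φ i g • evalZA g

theorem coeffZA_apply (i : ι) (a : ZA G) :
    coeffZA φ i a = fourierCoeff φ i (a : FourierAlgebra G) := by
  simp only [coeffZA, LinearMap.smul_apply, LinearMap.sum_apply, smul_eq_mul, fourierCoeff,
    evalZA_apply]
  rw [div_eq_inv_mul]
  simp only [mul_comm (chr φ i _)]

theorem coeffStarZA_apply (i : ι) (a : ZA G) :
    coeffStarZA φ i a = star (fourierCoeff φ i (fourierStar (a : FourierAlgebra G))) := by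
  simp only [coeffStarZA, LinearMap.smul_apply, LinearMap.sum_apply, smul_eq_mul, fourierCoeff,
    evalZA_apply]
  rw [div_eq_inv_mul, star_mul', star_inv₀, star_natCast, star_sum]
  congr 1
  refine Finset.sum_congr rfl fun g _ => ?_
  rw [star_mul', fourierStar, star_star, star_chr, inv_inv, mul_comm]

theorem eq_sum_chrZA (a : ZA G) : a = ∑ i, coeffZA φ i a • chrZA φ i := by
  refine ZA.ext_eval fun g => ?_
  rw [map_sum, evalZA_apply, fourier_inversion φ a.2 g]
  refine Finset.sum_congr rfl fun i _ => ?_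
  rw [map_smul, coeffZA_apply]
  rfl

theorem eq_sum_chrStarZA (a : ZA G) : a = ∑ i, coeffStarZA φ i a • chrStarZA φ i := by
  refine ZA.ext_eval fun g => ?_
  have h := congrArg star (fourier_inversion φ (f := fourierStar (a : FourierAlgebra G))
    (fun g x => congrArg star (a.2 g x)) g)
  rw [fourierStar, star_star, star_sum] at h
  rw [map_sum, evalZA_apply, h]
  refine Finset.sum_congr rfl fun i _ => ?_
  rw [map_smul, coeffStarZA_apply, star_mul']
  rfl

/-- Each coefficient of a class indicator is `|C| / |G|` times a character value. One factor `|C|`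
turns the sum over classes into a sum over elements, and the other remains as the weight. -/
theorem sum_coeffZA_classInd (i j : ι) [Fintype (ConjClasses G)] :
    ∑ C, coeffZA φ i (classInd C) * coeffStarZA φ j (classInd C) =
      (∑ g, (classSize g : ℂ) * (chr φ i g⁻¹ * chr φ j g)) / (Fintype.card G : ℂ) ^ 2 := by
  classical
  have h1 : ∀ C, coeffZA φ i (classInd C) * coeffStarZA φ j (classInd C) =
      (∑ x : G, ∑ y : G, if ConjClasses.mk x = C then if IsConj x y then chr φ i x⁻¹ * chr φ j y
        else 0 else 0) / (Fintype.card G : ℂ) ^ 2 := by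
    intro C
    simp only [coeffZA, coeffStarZA, LinearMap.smul_apply, LinearMap.sum_apply, smul_eq_mul,
      evalZA_classInd]
    rw [mul_mul_mul_comm, Finset.sum_mul_sum, div_eq_inv_mul, sq, mul_inv]
    congr 1
    refine Finset.sum_congr rfl fun x _ => Finset.sum_congr rfl fun y _ => ?_
    by_cases hx : ConjClasses.mk x = C
    · subst hx
      simp only [if_true, mul_one, ConjClasses.mk_eq_mk_iff_isConj, mul_ite, mul_zero]
      exact if_congr isConj_comm rfl rfl
    · simp [hx]
  rw [Finset.sum_congr rfl fun C _ => h1 C, ← Finset.sum_div, Finset.sum_comm]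
  congr 1
  refine Finset.sum_congr rfl fun x _ => ?_
  rw [Finset.sum_comm]
  simp only [Finset.sum_ite_eq, Finset.mem_univ, if_true]
  rw [sum_ite_isConj (F := fun y => chr φ i x⁻¹ * chr φ j y) x fun g y => by
    rw [chr_conj], nsmul_eq_mul]

/-- Characters expand the first leg and their conjugates the second, so that the entries are
weighted versions of the row orthogonality sums. -/
theorem amenabilityConstant_ZA :
    amenabilityConstant (ZA G) = ENNReal.ofReal ((∑ i, ∑ j, (d i : ℝ) * d j *
      ‖∑ g : G, (classSize g : ℂ) * (chr φ i g⁻¹ * chr φ j g)‖) / (Fintype.card G : ℝ) ^ 2) := by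
  classical
  have hl : ∀ (C : ConjClasses G) (a : ZA G),
      classInd C * a = evalZA (Quotient.out C) a • classInd C := by
    intro C a
    refine ZA.ext_eval fun g => ?_
    rw [evalZA_mul, map_smul, evalZA_classInd, smul_eq_mul]
    split_ifs with hg
    · obtain ⟨x, hx⟩ := isConj_iff.1 (ConjClasses.mk_eq_mk_iff_isConj.1
        (hg.trans (Quotient.out_eq C).symm))
      rw [← evalZA_conj a g x, hx, mul_comm]
    · simp
  rw [amenabilityConstant_eq_enorm_diagonal (e := classInd) hl
    (fun C a => (mul_comm a _).trans (hl C a))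
    (fun C => ZA.ext_eval fun g => by rw [evalZA_mul, evalZA_classInd]; split_ifs <;> simp)
    (ZA.ext_eval fun g => by
      rw [map_sum]
      simp only [evalZA_classInd, Finset.sum_ite_eq, Finset.mem_univ, if_true]
      rfl), ← ofReal_norm,
    norm_diagonal_eq (β := coeffZA φ) (b := chrZA φ) (w := fun i => (d i : ℝ))
    (β' := coeffStarZA φ) (b' := chrStarZA φ) (w' := fun i => (d i : ℝ))
    (fun _ => Nat.cast_nonneg _) (fun _ => Nat.cast_nonneg _) (eq_sum_chrZA φ)
    (eq_sum_chrStarZA φ) (norm_chrZA_le φ) (norm_chrStarZA_le φ)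
    (fun a => by
      simp only [coeffZA_apply]
      exact sum_mul_norm_fourierCoeff_le φ a)
    (fun a => by
      simp only [coeffStarZA_apply, norm_star]
      exact (sum_mul_norm_fourierCoeff_le φ _).trans (fourierNorm_fourierStar_le _))]
  congr 1
  rw [Finset.sum_div]
  refine Finset.sum_congr rfl fun i _ => ?_
  rw [Finset.sum_div]
  refine Finset.sum_congr rfl fun j _ => ?_
  rw [sum_coeffZA_classInd, norm_div, norm_pow, Complex.norm_natCast, mul_div_assoc]

end CentralFourierAlgebra

/-! ### Block degrees as degrees of irreducible representations -/

section Irreducible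

variable {G : Type u} [Group G] [Fintype G]
variable {ι : Type} [Fintype ι] [DecidableEq ι] {d : ι → ℕ}
  (φ : L1 G ≃ₐ[ℂ] Π i, Matrix (Fin (d i)) (Fin (d i)) ℂ)

/-- The irreducible representation of `G` given by the `i`-th block. -/
noncomputable def blockRep (i : ι) : Representation ℂ G (Fin (d i) → ℂ) where
  toFun g := Matrix.toLin' (φ (delta g) i)
  map_one' := by rw [delta_one, map_one, Pi.one_apply, Matrix.toLin'_one]; rfl
  map_mul' g h := by
    rw [← delta_mul_delta, map_mul, Pi.mul_apply, Matrix.toLin'_mul]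
    rfl

theorem mulVec_mem_subrepresentation (i : ι) (p : Subrepresentation (blockRep φ i))
    {v : Fin (d i) → ℂ} (hv : v ∈ p.toSubmodule) (a : L1 G) :
    Matrix.mulVec (φ a i) v ∈ p.toSubmodule := by
  rw [eq_sum_delta a, map_sum, Finset.sum_apply, Matrix.sum_mulVec]
  refine Submodule.sum_mem _ fun g _ => ?_
  rw [map_smul, Pi.smul_apply, Matrix.smul_mulVec]
  exact Submodule.smul_mem _ _ (p.apply_mem_toSubmodule g hv)

/-- The group algebra maps onto the full matrix algebra of the block, which moves any nonzero vector
to any other vector. -/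
theorem isIrreducible_blockRep [∀ i, NeZero (d i)] (i : ι) : (blockRep φ i).IsIrreducible := by
  have hnt : Nontrivial (Subrepresentation (blockRep φ i)) := by
    refine ⟨⊥, ⊤, fun h => ?_⟩
    have h1 : (⊥ : Submodule ℂ (Fin (d i) → ℂ)) = ⊤ :=
      congrArg Subrepresentation.toSubmodule h
    exact bot_ne_top h1
  refine { hnt with eq_bot_or_eq_top := fun p => ?_ }
  by_cases hp : ∃ v ∈ p.toSubmodule, v ≠ 0
  · right
    obtain ⟨v, hv, hv0⟩ := hp
    obtain ⟨k, hk⟩ := Function.ne_iff.1 hv0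
    refine Subrepresentation.toSubmodule_injective (eq_top_iff.2 fun w _ => ?_)
    -- The rank-one matrix used here sends `v` to `w`, because coordinate `k` of `v` is nonzero.
    have h := mulVec_mem_subrepresentation φ i p hv
      (φ.symm (Pi.single i (Matrix.vecMulVec w (Pi.single k (v k)⁻¹))))
    rw [φ.apply_symm_apply, Pi.single_eq_same, Matrix.vecMulVec_mulVec, single_dotProduct,
      inv_mul_cancel₀ hk] at h
    simpa using h
  · left
    push Not at hp
    refine Subrepresentation.toSubmodule_injective ?_
    exact (Submodule.eq_bot_iff _).2 hp

include φ in
theorem degree_mem_cd [∀ i, NeZero (d i)] (i : ι) : d i ∈ cd G :=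
  ⟨blockRep φ i, isIrreducible_blockRep φ i⟩

theorem pos_of_mem_cd {m : ℕ} (hm : m ∈ cd G) : 0 < m := by
  obtain ⟨ρ, hρ⟩ := hm
  rcases Nat.eq_zero_or_pos m with rfl | h
  · have : (⊥ : Subrepresentation ρ) = ⊤ :=
      Subrepresentation.toSubmodule_injective (Subsingleton.elim _ _)
    have := hρ.toNontrivial
    exact absurd ‹(⊥ : Subrepresentation ρ) = ⊤› bot_ne_top
  · exact h

end Irreducible

/-! ### Linear characters -/

section LinearCharacters

variable {G : Type u} [Group G] [Fintype G]
variable {ι : Type} [Fintype ι] [DecidableEq ι] {d : ι → ℕ}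
  (φ : L1 G ≃ₐ[ℂ] Π i, Matrix (Fin (d i)) (Fin (d i)) ℂ)

theorem trace_mul_of_eq_one {k : ℕ} (hk : k = 1) (M N : Matrix (Fin k) (Fin k) ℂ) :
    (M * N).trace = M.trace * N.trace := by
  subst hk
  simp [Matrix.trace, Matrix.mul_apply]

theorem chr_mul {i : ι} (hi : d i = 1) (g h : G) :
    chr φ i (g * h) = chr φ i g * chr φ i h := by
  rw [chr, blockTrace, ← delta_mul_delta, map_mul, Pi.mul_apply, trace_mul_of_eq_one hi]
  rfl

theorem chr_mul_chr_inv {i : ι} (hi : d i = 1) (g : G) : chr φ i g * chr φ i g⁻¹ = 1 := by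
  rw [← chr_mul φ hi, mul_inv_cancel, chr_one, hi, Nat.cast_one]

variable [∀ i, NeZero (d i)]

include φ in
theorem sum_degree_sq : ∑ i, (d i : ℂ) ^ 2 = Fintype.card G := by
  have h := card_mul_val_one φ (1 : L1 G)
  rw [← delta_one] at h
  classical
  rw [val_delta, if_pos rfl, mul_one] at h
  rw [h]
  refine Finset.sum_congr rfl fun i _ => ?_
  rw [show blockTrace φ i (delta 1) = chr φ i 1 from rfl, chr_one, sq]

theorem chr_injective : Function.Injective (chr φ) := by
  intro i j hij
  by_contra hne
  have h1 := sum_chr_inv_mul_chr φ i j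
  rw [← hij, sum_chr_inv_mul_chr, if_pos rfl, if_neg hne] at h1
  exact card_ne_zero h1

/-- The element `∑ X(g⁻¹) g` is central and nonzero, so it survives in some block. There its product
with the block idempotent is proportional both to that idempotent and to the element itself, which
gives `chr φ i = d i * X`; row orthogonality then forces `d i = 1`. -/
theorem exists_chr_eq {X : G → ℂ} (h1 : X 1 = 1) (hmul : ∀ g h, X (g * h) = X g * X h) :
    ∃ i, d i = 1 ∧ chr φ i = X := by
  have hinv : ∀ g, X g⁻¹ * X g = 1 := fun g => by rw [← hmul, inv_mul_cancel, h1]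
  set t : L1 G := L1.ofFun fun g => X g⁻¹ with ht
  have htc : t ∈ Subalgebra.center ℂ (L1 G) := by
    rw [mem_center_iff_val]
    intro g x
    simp only [ht, L1.val_ofFun, mul_inv_rev, hmul, inv_inv]
    linear_combination X g⁻¹ * hinv x
  have ht0 : t ≠ 0 := by
    intro h
    have h2 := congrArg (fun f => L1.val f 1) h
    simp [ht, L1.val_ofFun, L1.val_zero, h1] at h2
  obtain ⟨i, hi⟩ : ∃ i, centralChr φ i t ≠ 0 := by
    by_contra! hcon
    refine ht0 ((eq_sum_idem φ htc).trans (Finset.sum_eq_zero fun i _ => ?_))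
    rw [hcon, zero_smul]
  have hval : ∀ x, (t * idem φ i).val x = X x⁻¹ * ∑ z, X z * (idem φ i).val z := by
    intro x
    rw [L1.val_mul, ← Equiv.sum_comp ((Equiv.inv G).trans (Equiv.mulLeft x)), Finset.mul_sum]
    refine Finset.sum_congr rfl fun z _ => ?_
    simp only [ht, L1.val_ofFun, Equiv.trans_apply, Equiv.inv_apply, Equiv.coe_mulLeft,
      mul_inv_rev, inv_inv, hmul]
    rw [inv_mul_cancel_right]
    ring
  have hd : (d i : ℂ) ≠ 0 := Nat.cast_ne_zero.2 (NeZero.ne _)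
  have hn := card_ne_zero (G := G)
  set K := ∑ z, X z * (idem φ i).val z with hK
  -- Two evaluations of `t * idem φ i` at `x⁻¹`: as a scalar multiple of the idempotent, and by the
  -- convolution formula.
  have hchr : ∀ x, centralChr φ i t * (d i * chr φ i x / Fintype.card G) = X x * K := by
    intro x
    have h2 := hval x⁻¹
    rwa [mul_idem φ htc, L1.val_smul, val_idem, inv_inv] at h2
  have hchr' : ∀ x, chr φ i x = d i * X x := by
    intro x
    have h2 := hchr x
    have h3 := hchr 1
    rw [chr_one, h1, one_mul] at h3
    rw [← h3] at h2
    field_simp at h2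
    linear_combination h2
  have h4 := sum_chr_inv_mul_chr φ i i
  rw [if_pos rfl] at h4
  have h5 : ∀ g, chr φ i g⁻¹ * chr φ i g = (d i : ℂ) ^ 2 := by
    intro g
    rw [hchr', hchr']
    linear_combination (d i : ℂ) ^ 2 * hinv g
  rw [Finset.sum_congr rfl fun g _ => h5 g, Finset.sum_const, Finset.card_univ, nsmul_eq_mul] at h4
  have h6 : ((d i ^ 2 : ℕ) : ℂ) = (1 : ℕ) := by
    push_cast
    exact mul_left_cancel₀ hn (h4.trans (mul_one _).symm)
  have h7 : d i = 1 := by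
    have := Nat.cast_injective h6
    exact (Nat.pow_eq_one.1 this).resolve_right two_ne_zero
  refine ⟨i, h7, funext fun x => ?_⟩
  rw [hchr', h7, Nat.cast_one, one_mul]

variable (d) in
/-- The set of blocks of degree one. -/
def linearBlocks : Finset ι := Finset.univ.filter fun i => d i = 1

omit [DecidableEq ι] [∀ i, NeZero (d i)] in
theorem mem_linearBlocks {i : ι} : i ∈ linearBlocks d ↔ d i = 1 := by
  simp [linearBlocks]

-- Multiplication by a linear character `χ_j` permutes the linear characters, so the sum `S`
-- satisfies `χ_j(x) S = S` and vanishes if some `χ_j(x) ≠ 1`.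
open Classical in
theorem sum_linear_chr (x : G) : ∑ i ∈ linearBlocks d, chr φ i x =
    if ∀ i ∈ linearBlocks d, chr φ i x = 1 then ((linearBlocks d).card : ℂ) else 0 := by
  split_ifs with h
  · rw [Finset.sum_congr rfl h]
    simp
  · push Not at h
    obtain ⟨j, hj, hjx⟩ := h
    have hj1 := mem_linearBlocks.1 hj
    -- Outside the linear blocks the permutation takes the irrelevant value `i`.
    have hex : ∀ i, ∃ k, i ∈ linearBlocks d →
        k ∈ linearBlocks d ∧ chr φ k = fun g => chr φ j g * chr φ i g := by
      intro i
      by_cases hi : d i = 1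
      · obtain ⟨k, hk, hk'⟩ := exists_chr_eq φ (X := fun g => chr φ j g * chr φ i g)
          (by simp [chr_one, hi, hj1]) fun g h => by
            rw [chr_mul φ hj1, chr_mul φ hi]
            ring
        exact ⟨k, fun _ => ⟨mem_linearBlocks.2 hk, hk'⟩⟩
      · exact ⟨i, fun h => absurd (mem_linearBlocks.1 h) hi⟩
    choose σ hσ using hex
    have hinj : Set.InjOn σ (linearBlocks d) := by
      intro a ha b hb hab
      apply chr_injective φ
      have h1 := (hσ a ha).2
      rw [hab, (hσ b hb).2] at h1
      funext g
      have h2 : chr φ j g ≠ 0 := left_ne_zero_of_mul_eq_one (chr_mul_chr_inv φ hj1 g)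
      exact mul_left_cancel₀ h2 (congrFun h1 g).symm
    have hmaps : Set.MapsTo σ (linearBlocks d) (linearBlocks d) := fun i hi => (hσ i hi).1
    have h1 : ∑ i ∈ linearBlocks d, chr φ j x * chr φ i x = ∑ i ∈ linearBlocks d, chr φ i x :=
      Finset.sum_nbij σ hmaps hinj
        (Finset.surjOn_of_injOn_of_card_le σ hmaps hinj le_rfl)
        fun i hi => (congrFun (hσ i hi).2 x).symm
    rw [← Finset.mul_sum] at h1
    have h2 : (chr φ j x - 1) * ∑ i ∈ linearBlocks d, chr φ i x = 0 := by
      linear_combination h1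
    exact (mul_eq_zero.1 h2).resolve_left (sub_ne_zero.2 hjx)

/-- Only the trivial character has nonzero sum over the group. With `sum_linear_chr`, this counts
the common kernel of the linear characters as `|G| / l`. -/
theorem sum_sum_linear_chr : ∑ x, ∑ i ∈ linearBlocks d, chr φ i x = Fintype.card G := by
  obtain ⟨j, hj, hj'⟩ := exists_chr_eq φ (X := fun _ => 1) rfl fun _ _ => (mul_one _).symm
  have h1 : ∀ i, ∑ x, chr φ i x = if j = i then (Fintype.card G : ℂ) else 0 := by
    intro i
    rw [← sum_chr_inv_mul_chr φ]
    refine Finset.sum_congr rfl fun x _ => ?_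
    rw [hj', one_mul]
  rw [Finset.sum_comm, Finset.sum_congr rfl fun i _ => h1 i, Finset.sum_ite_eq,
    if_pos ((mem_linearBlocks (d := d)).2 hj)]

include φ in
-- In the column relation `∑ |χ_i(g)|² = |G| / |C_g|` each linear character contributes exactly 1.
theorem card_linearBlocks_le (g : G) :
    ((linearBlocks d).card : ℝ) ≤ Fintype.card G / classSize g := by
  have h1 := sum_chr_mul_chr_inv φ g g
  rw [if_pos (IsConj.refl g)] at h1
  have h2 : ∀ i, chr φ i g * chr φ i g⁻¹ = ((‖chr φ i g‖ ^ 2 : ℝ) : ℂ) := by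
    intro i
    rw [← star_chr, Complex.star_def, Complex.mul_conj, Complex.normSq_eq_norm_sq]
  have h3 : ∑ i, ‖chr φ i g‖ ^ 2 = (Fintype.card G : ℝ) / classSize g := by
    apply Complex.ofReal_injective
    rw [Complex.ofReal_sum, ← Finset.sum_congr rfl fun i _ => h2 i, h1]
    push_cast
    rfl
  rw [← h3, Finset.cast_card]
  refine (Finset.sum_le_sum fun i hi => ?_).trans
    (Finset.sum_le_univ_sum_of_nonneg fun i => by positivity)
  have h4 := h2 i
  rw [chr_mul_chr_inv φ (mem_linearBlocks.1 hi)] at h4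
  exact (Complex.ofReal_injective (by simpa using h4)).le

end LinearCharacters

/-! ### Evaluation for two degrees and two class sizes -/

section Evaluation

variable {G : Type u} [Group G] [Fintype G]
variable {ι : Type} [Fintype ι] [DecidableEq ι] {d : ι → ℕ} [∀ i, NeZero (d i)]
  (φ : L1 G ≃ₐ[ℂ] Π i, Matrix (Fin (d i)) (Fin (d i)) ℂ)

/-- Replace `d_i²` by `m² − (m² − 1)[d_i = 1]`. The first part is supported on conjugate pairs by
column orthogonality, the second on pairs with `g h⁻¹` in the common kernel of the linear
characters, which contains all conjugate pairs. -/
theorem sum_norm_sum_degree_sq_mul_chr {m : ℕ} (hm : 0 < m) (hdm : ∀ i, d i = 1 ∨ d i = m) :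
    ∑ g : G, ∑ h : G, ‖∑ i, (d i : ℂ) ^ 2 * (chr φ i g * chr φ i h⁻¹)‖ =
      (2 * (m : ℝ) ^ 2 - 1) * (Fintype.card G : ℝ) ^ 2 -
        2 * ((m : ℝ) ^ 2 - 1) * (linearBlocks d).card * ∑ g : G, (classSize g : ℝ) := by
  classical
  set l : ℝ := ((linearBlocks d).card : ℝ) with hl
  set n : ℝ := (Fintype.card G : ℝ) with hn
  have hm1 : (0 : ℝ) ≤ (m : ℝ) ^ 2 - 1 := by
    have : (1 : ℝ) ≤ m := by exact_mod_cast hm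
    nlinarith
  let P : G → Prop := fun x => ∀ i ∈ linearBlocks d, chr φ i x = 1
  have hP : ∀ x, ∑ i ∈ linearBlocks d, chr φ i x = ((if P x then l else 0 : ℝ) : ℂ) := by
    intro x
    rw [sum_linear_chr]
    show (if P x then _ else _) = _
    split_ifs <;> simp [hl]
  have hPsum : ∑ x, (if P x then l else 0) = n := by
    apply Complex.ofReal_injective
    rw [Complex.ofReal_sum, ← Finset.sum_congr rfl fun x _ => hP x, sum_sum_linear_chr]
    simp [hn]
  have hconj : ∀ g h : G, IsConj g h → P (g * h⁻¹) := by
    intro g h hgh i hi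
    have hi' := mem_linearBlocks.1 hi
    obtain ⟨x, rfl⟩ := isConj_iff.1 hgh
    rw [chr_mul φ hi', show (x * g * x⁻¹)⁻¹ = x * g⁻¹ * x⁻¹ by group, chr_conj,
      chr_mul_chr_inv φ hi']
  -- For non-conjugate pairs the inner sum is nonpositive and its sign flips. Writing the flipped
  -- term for all pairs overcounts on conjugate pairs, hence the factor 2.
  have hterm : ∀ g h : G, ‖∑ i, (d i : ℂ) ^ 2 * (chr φ i g * chr φ i h⁻¹)‖ =
      (if IsConj g h then (m : ℝ) ^ 2 * (n / classSize g) - 2 * ((m : ℝ) ^ 2 - 1) * l else 0) +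
        ((m : ℝ) ^ 2 - 1) * (if P (g * h⁻¹) then l else 0) := by
    intro g h
    have h1 : ∑ i, (d i : ℂ) ^ 2 * (chr φ i g * chr φ i h⁻¹) =
        (((m : ℝ) ^ 2 * (if IsConj g h then n / classSize g else 0) -
          ((m : ℝ) ^ 2 - 1) * (if P (g * h⁻¹) then l else 0) : ℝ) : ℂ) := by
      have h2 : ∀ i, (d i : ℂ) ^ 2 * (chr φ i g * chr φ i h⁻¹) =
          (m : ℂ) ^ 2 * (chr φ i g * chr φ i h⁻¹) - ((m : ℂ) ^ 2 - 1) *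
            (if d i = 1 then chr φ i (g * h⁻¹) else 0) := by
        intro i
        by_cases hi : d i = 1
        · rw [if_pos hi, chr_mul φ hi, hi]
          push_cast
          ring
        · rw [if_neg hi, (hdm i).resolve_left hi]
          ring
      rw [Finset.sum_congr rfl fun i _ => h2 i, Finset.sum_sub_distrib, ← Finset.mul_sum,
        ← Finset.mul_sum, sum_chr_mul_chr_inv]
      have h3 : ∑ i, (if d i = 1 then chr φ i (g * h⁻¹) else 0) = _ :=
        (Finset.sum_filter _ _).symm.trans (hP (g * h⁻¹))
      rw [h3]
      push_cast
      congr 2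
      split_ifs
      · simp [hn, classSize]
      · simp
    rw [h1, Complex.norm_real, Real.norm_eq_abs]
    by_cases hgh : IsConj g h
    -- This bound makes the inner sum nonnegative on conjugate pairs.
    · have hle : l ≤ n / classSize g := card_linearBlocks_le φ g
      have hl0 : 0 ≤ l := Nat.cast_nonneg _
      rw [if_pos hgh, if_pos hgh, if_pos (hconj g h hgh), abs_of_nonneg]
      · ring
      · nlinarith
    · rw [if_neg hgh, if_neg hgh, mul_zero, zero_sub, zero_add, abs_neg, abs_of_nonneg]
      split_ifs
      · exact mul_nonneg hm1 (Nat.cast_nonneg _)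
      · simp
  have hrow : ∀ g : G, ∑ h : G, ‖∑ i, (d i : ℂ) ^ 2 * (chr φ i g * chr φ i h⁻¹)‖ =
      (2 * (m : ℝ) ^ 2 - 1) * n - 2 * ((m : ℝ) ^ 2 - 1) * l * classSize g := by
    intro g
    have hc : (classSize g : ℝ) ≠ 0 := Nat.cast_ne_zero.2 (classSize_pos g).ne'
    have hPs : ∑ h, (if P (g * h⁻¹) then l else 0) = n := by
      rw [← hPsum]
      exact Equiv.sum_comp ((Equiv.inv G).trans (Equiv.mulLeft g)) fun x => if P x then l else 0
    rw [Finset.sum_congr rfl fun h _ => hterm g h, Finset.sum_add_distrib, ← Finset.mul_sum, hPs,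
      sum_ite_isConj (F := fun _ => (m : ℝ) ^ 2 * (n / classSize g) - 2 * ((m : ℝ) ^ 2 - 1) * l) g
        fun _ _ => rfl, nsmul_eq_mul]
    field_simp
    ring
  rw [Finset.sum_congr rfl fun g _ => hrow g, Finset.sum_sub_distrib,
    Finset.sum_const, Finset.card_univ, nsmul_eq_mul, ← Finset.mul_sum, ← hn]
  ring

theorem delta_mem_center {z : G} (hz : z ∈ Subgroup.center G) :
    delta z ∈ Subalgebra.center ℂ (L1 G) := by
  rw [Subalgebra.mem_center_iff]
  intro b
  refine L1.ext_val fun x => ?_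
  rw [val_mul_delta, val_delta_mul,
    Subgroup.mem_center_iff.1 (Subgroup.inv_mem _ hz) x]

theorem centralChr_mul {a b : L1 G} (ha : a ∈ Subalgebra.center ℂ (L1 G))
    (hb : b ∈ Subalgebra.center ℂ (L1 G)) (i : ι) :
    centralChr φ i (a * b) = centralChr φ i a * centralChr φ i b := by
  have h : idem φ i * (a * b) = (centralChr φ i a * centralChr φ i b) • idem φ i := by
    rw [← mul_assoc, idem_mul φ ha, smul_mul_assoc, idem_mul φ hb, smul_smul]
  rw [idem_mul φ (Subalgebra.mul_mem _ ha hb)] at h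
  exact smul_left_injective ℂ (idem_ne_zero φ i) h

/-- The central character of the `i`-th block, as a character of the centre of `G`. -/
noncomputable def centreHom (i : ι) : Subgroup.center G →* ℂ where
  toFun z := centralChr φ i (delta (z : G))
  map_one' := by
    have hd : (d i : ℂ) ≠ 0 := Nat.cast_ne_zero.2 (NeZero.ne _)
    rw [OneMemClass.coe_one, centralChr]
    exact (congrArg (· / (d i : ℂ)) (chr_one φ i)).trans (div_self hd)
  map_mul' z w := by
    rw [Subgroup.coe_mul, ← delta_mul_delta,
      centralChr_mul φ (delta_mem_center z.2) (delta_mem_center w.2)]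

theorem chr_eq_centreHom (i : ι) (z : Subgroup.center G) :
    chr φ i z = d i * centreHom φ i z := by
  have hd : (d i : ℂ) ≠ 0 := Nat.cast_ne_zero.2 (NeZero.ne _)
  exact (mul_div_cancel₀ _ hd).symm.trans (by rw [div_eq_mul_inv]; rfl)

-- The summand is a homomorphism from the centre to ℂ, and its sum vanishes unless it is trivial.
-- Different blocks may share a central character, so the test is equality of homomorphisms, not of
-- indices.
open Classical in
theorem sum_centreHom_inv_mul [Fintype (Subgroup.center G)] (i j : ι) :
    ∑ z : Subgroup.center G, centreHom φ i z⁻¹ * centreHom φ j z =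
      if centreHom φ i = centreHom φ j then (Fintype.card (Subgroup.center G) : ℂ) else 0 := by
  let X : Subgroup.center G →* ℂ :=
    { toFun := fun z => centreHom φ i z⁻¹ * centreHom φ j z
      map_one' := by simp
      map_mul' := fun z w => by
        rw [mul_inv_rev, map_mul, map_mul]
        ring }
  have h1 : X = 1 ↔ centreHom φ i = centreHom φ j := by
    have hinv : ∀ z, centreHom φ i z⁻¹ * centreHom φ i z = 1 := fun z => by
      rw [← map_mul, inv_mul_cancel, map_one]
    constructor
    · intro h
      ext z
      have h2 : centreHom φ i z⁻¹ * centreHom φ j z = 1 := DFunLike.congr_fun h z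
      have h3 := left_ne_zero_of_mul_eq_one (hinv z)
      exact mul_left_cancel₀ h3 ((hinv z).trans h2.symm)
    · intro h
      ext z
      show centreHom φ i z⁻¹ * centreHom φ j z = 1
      rw [← h, hinv]
  have h2 := sum_hom_units X
  rw [show ∑ z, centreHom φ i z⁻¹ * centreHom φ j z = ∑ z, X z from rfl, h2]
  push_cast
  exact if_congr h1 rfl rfl

-- Average `card_mul_val_one`, applied to the central point masses, against the central character of
-- block `i`; only the identity survives. Hence the blocks with a given central character have
-- squared degrees summing to `|G| / |Z(G)|`.
open Classical in
theorem sum_degree_sq_same_centreHom [Fintype (Subgroup.center G)] (i : ι) :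
    ∑ j, (d j : ℝ) ^ 2 * (if centreHom φ i = centreHom φ j then
      (Fintype.card (Subgroup.center G) : ℝ) else 0) = Fintype.card G := by
  apply Complex.ofReal_injective
  have h1 : ∀ j, (((d j : ℝ) ^ 2 * (if centreHom φ i = centreHom φ j then
      (Fintype.card (Subgroup.center G) : ℝ) else 0) : ℝ) : ℂ) =
      ∑ z : Subgroup.center G, centreHom φ i z⁻¹ * (d j * blockTrace φ j (delta (z : G))) := by
    intro j
    have h2 : ∀ z : Subgroup.center G, blockTrace φ j (delta (z : G)) = d j * centreHom φ j z :=
      chr_eq_centreHom φ j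
    have h3 : (((if centreHom φ i = centreHom φ j then (Fintype.card (Subgroup.center G) : ℝ)
        else 0 : ℝ)) : ℂ) = ∑ z : Subgroup.center G, centreHom φ i z⁻¹ * centreHom φ j z := by
      rw [sum_centreHom_inv_mul]
      split_ifs <;> simp
    rw [Complex.ofReal_mul, h3, Finset.mul_sum]
    refine Finset.sum_congr rfl fun z _ => ?_
    rw [h2]
    push_cast
    ring
  rw [Complex.ofReal_sum, Finset.sum_congr rfl fun j _ => h1 j, Finset.sum_comm]
  simp only [← Finset.mul_sum, ← card_mul_val_one]
  rw [Finset.sum_eq_single 1]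
  · simp [val_delta]
  · intro z _ hz
    have : (1 : G) ≠ z := fun h => hz (Subtype.ext h.symm)
    simp [val_delta, this]
  · simp

theorem mem_center_iff_isConj {g : G} :
    g ∈ Subgroup.center G ↔ ∀ x, IsConj g x → x = g := by
  rw [Subgroup.mem_center_iff]
  constructor
  · rintro h x hx
    obtain ⟨c, rfl⟩ := isConj_iff.1 hx
    rw [h c, mul_inv_cancel_right]
  · intro h c
    exact mul_inv_eq_iff_eq_mul.1 (h _ (isConj_iff.2 ⟨c, rfl⟩))

theorem classSize_eq_one_iff {g : G} : classSize g = 1 ↔ g ∈ Subgroup.center G := by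
  classical
  rw [mem_center_iff_isConj, ← card_filter_isConj, Finset.card_eq_one]
  constructor
  · rintro ⟨a, ha⟩ x hx
    have h1 : x ∈ ({a} : Finset G) := by rw [← ha]; exact Finset.mem_filter.2 ⟨Finset.mem_univ _, hx⟩
    have h2 : g ∈ ({a} : Finset G) := by
      rw [← ha]; exact Finset.mem_filter.2 ⟨Finset.mem_univ _, IsConj.refl g⟩
    rw [Finset.mem_singleton.1 h1, Finset.mem_singleton.1 h2]
  · intro h
    refine ⟨g, Finset.ext fun x => ?_⟩
    simp only [Finset.mem_filter, Finset.mem_univ, true_and, Finset.mem_singleton]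
    exact ⟨h x, fun hx => hx ▸ IsConj.refl _⟩

open Classical in
theorem sum_ite_mem_center [Fintype (Subgroup.center G)] {M : Type*} [AddCommMonoid M] (F : G → M) :
    (∑ g, if g ∈ Subgroup.center G then F g else 0) = ∑ z : Subgroup.center G, F z := by
  rw [← Finset.sum_filter]
  exact (Finset.sum_subtype _ (by simp) F)

/-- The dual of `sum_norm_sum_degree_sq_mul_chr`: the centre plays the role of the linear
characters, equality of central characters that of the common kernel, and `(d i)² z ≤ n` (`hdz`)
gives the sign on the diagonal `i = j`. -/
theorem sum_degree_mul_norm_sum_classSize [Fintype (Subgroup.center G)] {s : ℕ} (hs : 0 < s)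
    (hcs : ∀ g : G, classSize g = 1 ∨ classSize g = s) :
    ∑ i, ∑ j, (d i : ℝ) * d j * ‖∑ g : G, (classSize g : ℂ) * (chr φ i g⁻¹ * chr φ j g)‖ =
      (2 * (s : ℝ) - 1) * (Fintype.card G : ℝ) ^ 2 -
        2 * ((s : ℝ) - 1) * Fintype.card (Subgroup.center G) * ∑ i, (d i : ℝ) ^ 4 := by
  classical
  set z : ℝ := (Fintype.card (Subgroup.center G) : ℝ) with hz
  set n : ℝ := (Fintype.card G : ℝ) with hn
  have hs1 : (0 : ℝ) ≤ (s : ℝ) - 1 := by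
    have : (1 : ℝ) ≤ s := by exact_mod_cast hs
    linarith
  let Q : ι → ι → Prop := fun i j => centreHom φ i = centreHom φ j
  have hQsum : ∀ i, ∑ j, (d j : ℝ) ^ 2 * (if Q i j then z else 0) = n :=
    sum_degree_sq_same_centreHom φ
  have hdz : ∀ i, (d i : ℝ) ^ 2 * z ≤ n := by
    intro i
    rw [← hQsum i]
    refine le_trans (le_of_eq ?_) (Finset.single_le_sum (f := fun j => (d j : ℝ) ^ 2 *
      (if Q i j then z else 0)) (fun j _ => ?_) (Finset.mem_univ i))
    · simp [Q]
    · refine mul_nonneg (by positivity) ?_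
      split_ifs
      · exact Nat.cast_nonneg _
      · exact le_rfl
  have hterm : ∀ i j, (d i : ℝ) * d j *
      ‖∑ g : G, (classSize g : ℂ) * (chr φ i g⁻¹ * chr φ j g)‖ =
      (if i = j then (d i : ℝ) ^ 2 * (s * n) - 2 * ((s : ℝ) - 1) * z * (d i : ℝ) ^ 4 else 0) +
        ((s : ℝ) - 1) * (d i : ℝ) ^ 2 * ((d j : ℝ) ^ 2 * (if Q i j then z else 0)) := by
    intro i j
    have h1 : ∑ g : G, (classSize g : ℂ) * (chr φ i g⁻¹ * chr φ j g) =
        ((s * (if i = j then n else 0) - ((s : ℝ) - 1) * (d i * d j * (if Q i j then z else 0)) :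
          ℝ) : ℂ) := by
      have h2 : ∀ g, (classSize g : ℂ) * (chr φ i g⁻¹ * chr φ j g) =
          (s : ℂ) * (chr φ i g⁻¹ * chr φ j g) - ((s : ℂ) - 1) *
            (if g ∈ Subgroup.center G then chr φ i g⁻¹ * chr φ j g else 0) := by
        intro g
        by_cases hg : g ∈ Subgroup.center G
        · rw [if_pos hg, classSize_eq_one_iff.2 hg]
          push_cast
          ring
        · rw [if_neg hg, (hcs g).resolve_left (mt classSize_eq_one_iff.1 hg)]
          ring
      have h3 : ∑ w : Subgroup.center G, chr φ i (w : G)⁻¹ * chr φ j w =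
          d i * d j * ∑ w : Subgroup.center G, centreHom φ i w⁻¹ * centreHom φ j w := by
        rw [Finset.mul_sum]
        refine Finset.sum_congr rfl fun w _ => ?_
        rw [← Subgroup.coe_inv, chr_eq_centreHom, chr_eq_centreHom]
        ring
      rw [Finset.sum_congr rfl fun g _ => h2 g, Finset.sum_sub_distrib, ← Finset.mul_sum,
        ← Finset.mul_sum, sum_ite_mem_center, h3, sum_centreHom_inv_mul, sum_chr_inv_mul_chr]
      push_cast
      congr 2
      · split_ifs <;> simp [hn]
      · by_cases hq : centreHom φ i = centreHom φ j
        · rw [if_pos hq, if_pos (show Q i j from hq)]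
          simp [hz]
        · rw [if_neg hq, if_neg (show ¬Q i j from hq)]
          simp
    rw [h1, Complex.norm_real, Real.norm_eq_abs]
    by_cases hij : i = j
    · subst hij
      have h4 := hdz i
      have h5 : 0 ≤ (d i : ℝ) ^ 2 * z := mul_nonneg (by positivity) (Nat.cast_nonneg _)
      rw [if_pos rfl, if_pos rfl, if_pos rfl, abs_of_nonneg]
      · ring
      · nlinarith
    · rw [if_neg hij, if_neg hij, mul_zero, zero_sub, zero_add, abs_neg, abs_of_nonneg]
      · ring
      · refine mul_nonneg hs1 (mul_nonneg (by positivity) ?_)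
        split_ifs
        · exact Nat.cast_nonneg _
        · exact le_rfl
  have hdsq : ∑ i, (d i : ℝ) ^ 2 = n := by
    apply Complex.ofReal_injective
    have := sum_degree_sq φ
    push_cast
    rw [this, hn]
    simp
  have hrow : ∀ i, ∑ j, (d i : ℝ) * d j *
      ‖∑ g : G, (classSize g : ℂ) * (chr φ i g⁻¹ * chr φ j g)‖ =
      (2 * (s : ℝ) - 1) * n * (d i : ℝ) ^ 2 - 2 * ((s : ℝ) - 1) * z * (d i : ℝ) ^ 4 := by
    intro i
    rw [Finset.sum_congr rfl fun j _ => hterm i j, Finset.sum_add_distrib, ← Finset.mul_sum,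
      hQsum, Finset.sum_ite_eq, if_pos (Finset.mem_univ _)]
    ring
  rw [Finset.sum_congr rfl fun i _ => hrow i, Finset.sum_sub_distrib, ← Finset.mul_sum,
    ← Finset.mul_sum, hdsq]
  ring

-- Count `∑_g ∑_i χ_i(g) χ_i(g⁻¹)` by rows and by columns. The right side is the number of classes,
-- written as a sum over elements.
include φ in
theorem card_blocks_eq_sum_inv_classSize :
    (Fintype.card ι : ℝ) = ∑ g : G, (classSize g : ℝ)⁻¹ := by
  have h1 : ∑ g : G, ∑ i, chr φ i g * chr φ i g⁻¹ = Fintype.card ι * Fintype.card G := by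
    rw [Finset.sum_comm]
    have h2 : ∀ i, ∑ g, chr φ i g * chr φ i g⁻¹ = Fintype.card G := by
      intro i
      have := sum_chr_inv_mul_chr φ i i
      rw [if_pos rfl] at this
      rw [← this]
      exact Finset.sum_congr rfl fun g _ => mul_comm _ _
    rw [Finset.sum_congr rfl fun i _ => h2 i, Finset.sum_const, Finset.card_univ, nsmul_eq_mul]
  have h2 : ∀ g : G, ∑ i, chr φ i g * chr φ i g⁻¹ = Fintype.card G * (classSize g : ℂ)⁻¹ := by
    intro g
    rw [sum_chr_mul_chr_inv, if_pos (IsConj.refl g), div_eq_mul_inv]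
    rfl
  rw [Finset.sum_congr rfl fun g _ => h2 g, ← Finset.mul_sum, mul_comm] at h1
  apply Complex.ofReal_injective
  push_cast
  exact (mul_right_cancel₀ card_ne_zero h1).symm

include φ in
theorem amenabilityConstant_ZA_eq_ZL1 {m s : ℕ} (hm : 0 < m) (hs : 0 < s)
    (hdm : ∀ i, d i = 1 ∨ d i = m) (hcs : ∀ g : G, classSize g = 1 ∨ classSize g = s) :
    amenabilityConstant (ZA G) = amenabilityConstant (ZL1 G) := by
  classical
  rw [amenabilityConstant_ZA φ, amenabilityConstant_ZL1 φ, sum_norm_sum_degree_sq_mul_chr φ hm hdm,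
    sum_degree_mul_norm_sum_classSize φ hs hcs]
  congr 2
  have hdsq : ∑ i, (d i : ℝ) ^ 2 = Fintype.card G := by
    apply Complex.ofReal_injective
    have := sum_degree_sq φ
    push_cast
    exact this
  have hind : ∑ i, (if d i = 1 then (1 : ℝ) else 0) = (linearBlocks d).card := by
    rw [Finset.sum_boole]
    rfl
  have hcen : ∑ g : G, (if g ∈ Subgroup.center G then (1 : ℝ) else 0) =
      Fintype.card (Subgroup.center G) := by
    rw [sum_ite_mem_center fun _ => (1 : ℝ)]
    simp
  have hr := card_blocks_eq_sum_inv_classSize φ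
  set l : ℝ := ((linearBlocks d).card : ℝ)
  set n : ℝ := (Fintype.card G : ℝ) with hn
  set z : ℝ := (Fintype.card (Subgroup.center G) : ℝ)
  have h4 : ∑ i, (d i : ℝ) ^ 4 = (m : ℝ) ^ 2 * n - ((m : ℝ) ^ 2 - 1) * l := by
    rw [← hdsq, ← hind, Finset.mul_sum, Finset.mul_sum, ← Finset.sum_sub_distrib]
    refine Finset.sum_congr rfl fun i _ => ?_
    by_cases hi : d i = 1
    · rw [if_pos hi, hi]; push_cast; ring
    · rw [if_neg hi, (hdm i).resolve_left hi]; ring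
  -- A linear block counts `1 + (m² − 1)` and any other block counts `m²`; `hc2` is the same count
  -- for classes.
  have h0 : (m : ℝ) ^ 2 * Fintype.card ι = n + ((m : ℝ) ^ 2 - 1) * l := by
    rw [← hdsq, ← hind, Finset.mul_sum, ← Finset.sum_add_distrib, ← Finset.card_univ,
      Finset.cast_card, Finset.mul_sum]
    refine Finset.sum_congr rfl fun i _ => ?_
    by_cases hi : d i = 1
    · rw [if_pos hi, hi]; push_cast; ring
    · rw [if_neg hi, (hdm i).resolve_left hi]; ring
  have hone : ∑ _g : G, (1 : ℝ) = n := by simp [hn]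
  have hc1 : ∑ g : G, (classSize g : ℝ) = s * n - ((s : ℝ) - 1) * z := by
    rw [← hone, ← hcen, Finset.mul_sum, Finset.mul_sum, ← Finset.sum_sub_distrib]
    refine Finset.sum_congr rfl fun g _ => ?_
    by_cases hg : g ∈ Subgroup.center G
    · rw [if_pos hg, classSize_eq_one_iff.2 hg]; push_cast; ring
    · rw [if_neg hg, (hcs g).resolve_left (mt classSize_eq_one_iff.1 hg)]; ring
  have hs0 : (s : ℝ) ≠ 0 := Nat.cast_ne_zero.2 hs.ne'
  have hc2 : (s : ℝ) * Fintype.card ι = n + ((s : ℝ) - 1) * z := by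
    rw [hr, ← hone, ← hcen, Finset.mul_sum, Finset.mul_sum, ← Finset.sum_add_distrib]
    refine Finset.sum_congr rfl fun g _ => ?_
    by_cases hg : g ∈ Subgroup.center G
    · rw [if_pos hg, classSize_eq_one_iff.2 hg]; push_cast; ring
    · rw [if_neg hg, (hcs g).resolve_left (mt classSize_eq_one_iff.1 hg), mul_inv_cancel₀ hs0]
      ring
  -- After substitution the products of `l` and `z` agree on both sides. What remains is settled by
  -- the two expressions `h0` and `hc2` for the common number of blocks and classes.
  rw [h4, hc1]
  linear_combination 2 * n * (m : ℝ) ^ 2 * hc2 - 2 * n * (s : ℝ) * h0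

end Evaluation

end CentralFourier

theorem theorem4p6 {G : Type*} [Group G] [Fintype G] (m s : ℕ)
    (hcd : CentralFourier.cd G = {1, m}) (hcc : CentralFourier.cc G = {1, s}) :
    CentralFourier.amenabilityConstant (CentralFourier.ZA G) =
      CentralFourier.amenabilityConstant (CentralFourier.ZL1 G) := by
  obtain ⟨r, d, hd, ⟨φ⟩⟩ := CentralFourier.exists_blocks G
  have hm : m ∈ CentralFourier.cd G := by rw [hcd]; simp
  have hs : s ∈ CentralFourier.cc G := by rw [hcc]; simp
  refine CentralFourier.amenabilityConstant_ZA_eq_ZL1 (s := s) φ (CentralFourier.pos_of_mem_cd hm)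
    ?_ (fun i => ?_) (fun g => ?_)
  · obtain ⟨C, rfl⟩ := hs
    induction C using Quotient.inductionOn with
    | h g => exact CentralFourier.classSize_pos g
  · have h := CentralFourier.degree_mem_cd φ i
    rw [hcd] at h
    simpa using h
  · have h : CentralFourier.classSize g ∈ CentralFourier.cc G := ⟨ConjClasses.mk g, rfl⟩
    rw [hcc] at h
    simpa using h
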